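/- Let $n\ge 0$ and let $(Y,\xi)$ be a smooth contact manifold of dimension $2n+1$: $\xi\subset TY$ is a field of hyperplanes such that every point of $Y$ has an open neighborhood $U$ carrying a smooth nowhere-zero $1$-form $\alpha$ (a contact form for $\xi|_U$) with $\ker\alpha=\xi|_U$ and with $d\alpha_q|_{\xi_q}$ nondegenerate for all $q\in U$; no coorientability is assumed. Submanifolds are smooth, embedded and without boundary, not necessarily closed as subsets. A submanifold $C\subset Y$ is called coisotropic if for every $p\in C$ and every contact form $\alpha$ for $\xi$ defined on a neighborhood of $p$ (the choice of $\alpha$ does not matter), the $d\alpha_p$-orthogonal complement of $T_pC\cap\xi_p$ in $\xi_p$ is contained in $T_pC\cap\xi_p$. A Legendrian submanifold is an $n$-dimensional submanifold $\Lambda\subset Y$ with $T_q\Lambda\subset\xi_q$ for all $q\in\Lambda$. Let $C$ be a coisotropic submanifold of $(Y,\xi)$, and let $p\in C$ with $T_pC\not\subset\xi_p$. Then there is a Legendrian submanifold $\Lambda$ of $Y$ such that $p\in\Lambda\subset C$. -/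

import Mathlib

open Set Filter Topology Manifold
open scoped ContDiff

namespace ContactGeometry

noncomputable section

/-- The model space `ℝᵐ`. -/
abbrev Model (m : ℕ) : Type := EuclideanSpace ℝ (Fin m)

section Manifolds

variable {m : ℕ} {Y : Type*} [TopologicalSpace Y] [ChartedSpace (Model m) Y]

/-- `C ⊆ Y` is a (smooth, embedded, boundaryless) submanifold of dimension `d` of the smooth
`m`-manifold `Y`: around each of its points there is a smooth chart of `Y` in which `C` is the
intersection of the domain with a `d`-dimensional linear subspace. It need not be closed in `Y`. -/
def IsSubmanifold (m : ℕ) {Y : Type*} [TopologicalSpace Y] [ChartedSpace (Model m) Y]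
    (d : ℕ) (C : Set Y) : Prop :=
  ∀ p ∈ C, ∃ φ ∈ IsManifold.maximalAtlas (𝓡 m) ∞ Y, p ∈ φ.source ∧
    ∃ V : Submodule ℝ (Model m), Module.finrank ℝ V = d ∧
      ∀ q ∈ φ.source, (q ∈ C ↔ φ q ∈ V)

/-- The tangent space `T_p C ⊆ T_p Y`: the velocities at time `0` of the smooth curves `γ` in `Y`
with `γ 0 = p` which stay in `C` for small times. -/
def tangentSet (m : ℕ) {Y : Type*} [TopologicalSpace Y] [ChartedSpace (Model m) Y]
    (C : Set Y) (p : Y) : Set (TangentSpace (𝓡 m) p) :=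
  {v | ∃ γ : ℝ → Y, γ 0 = p ∧ (∀ᶠ t in 𝓝 (0 : ℝ), γ t ∈ C) ∧
    ContMDiffAt 𝓘(ℝ, ℝ) (𝓡 m) ∞ γ 0 ∧ mfderiv 𝓘(ℝ, ℝ) (𝓡 m) γ 0 (1 : ℝ) = v}

/-- A (not necessarily continuous) `1`-form on `Y`. -/
abbrev OneForm (m : ℕ) (Y : Type*) [TopologicalSpace Y] [ChartedSpace (Model m) Y] : Type _ :=
  ∀ q : Y, TangentSpace (𝓡 m) q →L[ℝ] ℝ

/-- The coordinate expression `(φ⁻¹)^* α` of a `1`-form in a chart `φ`; meaningful on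
`φ.target`. -/
def OneForm.inChart (α : OneForm m Y) (φ : OpenPartialHomeomorph Y (Model m))
    (x : Model m) : Model m →L[ℝ] ℝ :=
  (α (φ.symm x)).comp (mfderiv (𝓡 m) (𝓡 m) φ.symm x)

/-- The `1`-form `α` is smooth on the open set `U`: all its coordinate expressions are. -/
def OneForm.SmoothOn (α : OneForm m Y) (U : Set Y) : Prop :=
  ∀ φ ∈ IsManifold.maximalAtlas (𝓡 m) ∞ Y,
    ContDiffOn ℝ ∞ (α.inChart φ) (φ.target ∩ φ.symm ⁻¹' U)

/-- The exterior derivative `dα_p (v, w)` of a `1`-form that is smooth near `p`, computed in the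
preferred chart `φ` at `p`: if `a` is the coordinate expression of `α` and `x = φ p`,
`v' = dφ_p v`, `w' = dφ_p w`, it is `(D a_x v') w' - (D a_x w') v'`. -/
def OneForm.extDerivAt (α : OneForm m Y) (p : Y) (v w : TangentSpace (𝓡 m) p) : ℝ :=
  let φ := chartAt (Model m) p
  let v' : Model m := mfderiv (𝓡 m) (𝓡 m) φ p v
  let w' : Model m := mfderiv (𝓡 m) (𝓡 m) φ p w
  fderiv ℝ (α.inChart φ) (φ p) v' w' - fderiv ℝ (α.inChart φ) (φ p) w' v'

/-- `α` restricts to a contact form on the open set `U` with kernel `ξ`: it is smooth and nowhere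
zero on `U`, and for `q ∈ U` one has `ker α_q = ξ_q` and `dα_q` is nondegenerate on `ξ_q`.
(The values of `α` outside `U` are irrelevant.) -/
structure IsContactFormOn (ξ : ∀ q : Y, Submodule ℝ (TangentSpace (𝓡 m) q)) (U : Set Y)
    (α : OneForm m Y) : Prop where
  isOpen : IsOpen U
  smoothOn : α.SmoothOn U
  ne_zero : ∀ q ∈ U, α q ≠ 0
  ker_eq : ∀ q ∈ U, ∀ v : TangentSpace (𝓡 m) q, v ∈ ξ q ↔ α q v = 0
  nondegenerate : ∀ q ∈ U, ∀ v ∈ ξ q, (∀ w ∈ ξ q, α.extDerivAt q v w = 0) → v = 0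

end Manifolds

/-- A contact structure on a `(2n+1)`-dimensional manifold `Y`: a field of tangent hyperplanes
that is, locally, the kernel of a contact form. No coorientation is required. -/
structure ContactStructure (n : ℕ) (Y : Type*) [TopologicalSpace Y]
    [ChartedSpace (Model (2 * n + 1)) Y] where
  /-- the hyperplane `ξ_q ⊆ T_q Y` -/
  plane : ∀ q : Y, Submodule ℝ (TangentSpace (𝓡 (2 * n + 1)) q)
  exists_contactForm : ∀ p : Y, ∃ (U : Set Y) (α : OneForm (2 * n + 1) Y),
    p ∈ U ∧ IsContactFormOn plane U α

section Contact

variable {n : ℕ} {Y : Type*} [TopologicalSpace Y] [ChartedSpace (Model (2 * n + 1)) Y]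

/-- `C` is coisotropic at `p`: for every contact form `α` for `ξ` defined near `p`, the
`dα_p`-orthogonal complement of `T_p C ∩ ξ_p` in `ξ_p` is contained in `T_p C ∩ ξ_p`.
(Such forms exist, and the condition does not depend on which of them is used.) -/
def ContactStructure.IsCoisotropicAt (ξ : ContactStructure n Y) (C : Set Y) (p : Y) : Prop :=
  ∀ (U : Set Y) (α : OneForm (2 * n + 1) Y), p ∈ U → IsContactFormOn ξ.plane U α →
    ∀ v ∈ ξ.plane p,
      (∀ w ∈ tangentSet (2 * n + 1) C p ∩ (ξ.plane p : Set (TangentSpace (𝓡 (2 * n + 1)) p)),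
        α.extDerivAt p v w = 0) →
      v ∈ tangentSet (2 * n + 1) C p ∩ (ξ.plane p : Set (TangentSpace (𝓡 (2 * n + 1)) p))

/-- A coisotropic submanifold of dimension `d`. -/
def ContactStructure.IsCoisotropicSubmanifold (ξ : ContactStructure n Y) (d : ℕ) (C : Set Y) :
    Prop :=
  IsSubmanifold (2 * n + 1) d C ∧ ∀ p ∈ C, ξ.IsCoisotropicAt C p

/-- A Legendrian submanifold: a submanifold of dimension `n` everywhere tangent to `ξ`. -/
def ContactStructure.IsLegendrianSubmanifold (ξ : ContactStructure n Y) (Λ : Set Y) : Prop :=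
  IsSubmanifold (2 * n + 1) n Λ ∧
    ∀ q ∈ Λ, tangentSet (2 * n + 1) Λ q ⊆ (ξ.plane q : Set (TangentSpace (𝓡 (2 * n + 1)) q))

end Contact

end

end ContactGeometry

/-! The argument takes place on `C` and in its symplectization. Straighten `C` near `p` to a linear
subspace `V` of dimension `d`, and let `a` be the restriction of a contact form to `V`; it is
nonzero near `p` because `T_pC` is not contained in `ξ_p`. On `V × ℝ` consider `da + ds ∧ a`, which
is `d(e^s a)` up to the factor `e^s`. The same form on the ambient space times `ℝ` is symplectic,
and coisotropy of `C` says exactly that `V × ℝ` is coisotropic there. Hence its radical has constant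
dimension `k = 2n + 1 - d` (`finrank_ker_compl₁₂_of_orthogonal_le`).

It remains to find an integral manifold of `ker a` of dimension `n = (d + k - 1) / 2`, by induction
on `d` (`exists_integralImmersion`). If `k = 0`, a suitable hyperplane slice has corank `1`, with
the same `n`. If `k > 0`, the radical has a smooth section `(X, s)` near `p`, so that `a(X) = 0` and
`da(X, ·) = -s a`. A slice transverse to `X` lowers both `d` and `k` by one. The flow of `X`
preserves `ker a` (`flow_preserves_ker`), so it sweeps the integral manifold of the slice into one
of dimension one higher. Near `p` the resulting immersion is an embedding, and its image is the
Legendrian (`exists_submanifold_of_immersion`). -/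

namespace ContactGeometry

noncomputable section

/-! ### Inverse function theorem. -/

/-- The inverse function theorem with smoothness of both maps on whole neighbourhoods. -/
theorem exists_openPartialHomeomorph_contDiffOn {E F : Type*} [NormedAddCommGroup E]
    [NormedSpace ℝ E] [CompleteSpace E] [NormedAddCommGroup F] [NormedSpace ℝ F]
    {f : E → F} {U : Set E} (hU : IsOpen U) (hf : ContDiffOn ℝ ∞ f U) {a : E} (ha : a ∈ U)
    (e : E ≃L[ℝ] F) (he : HasFDerivAt f (e : E →L[ℝ] F) a) :
    ∃ φ : OpenPartialHomeomorph E F, (∀ x, φ x = f x) ∧ a ∈ φ.source ∧ φ.source ⊆ U ∧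
      ContDiffOn ℝ ∞ φ φ.source ∧ ContDiffOn ℝ ∞ φ.symm φ.target := by
  have hfa : ContDiffAt ℝ ∞ f a := hf.contDiffAt (hU.mem_nhds ha)
  let φ₀ := hfa.toOpenPartialHomeomorph f he (by simp)
  -- Invertible operators form an open set, so the derivative stays invertible on a neighbourhood;
  -- this makes the inverse smooth at every point of the target.
  let V : Set E := U ∩ fderiv ℝ f ⁻¹' range ((↑) : (E ≃L[ℝ] F) → E →L[ℝ] F)
  have hV : IsOpen V := (hf.continuousOn_fderiv_of_isOpen hU (by simp)).isOpen_inter_preimage hU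
    (ContinuousLinearEquiv.isOpen)
  have hs : (φ₀.restr V).source = φ₀.source ∩ V := φ₀.restr_source' V hV
  refine ⟨φ₀.restr V, fun x => rfl, ?_, ?_, ?_, ?_⟩
  · rw [hs]
    exact ⟨hfa.mem_toOpenPartialHomeomorph_source he (by simp), ha, e, he.fderiv.symm⟩
  · rw [hs]
    exact fun x hx => hx.2.1
  · rw [hs]
    exact hf.mono fun x hx => hx.2.1
  · intro y hy
    have hy' : (φ₀.restr V).symm y ∈ (φ₀.restr V).source := (φ₀.restr V).map_target hy
    rw [hs] at hy'
    obtain ⟨-, hyU, e', he'⟩ := hy'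
    have hd := hf.contDiffAt (hU.mem_nhds hyU)
    refine ((φ₀.restr V).contDiffAt_symm hy (f₀' := e') ?_ hd).contDiffWithinAt
    rw [he']
    exact (hd.differentiableAt (by simp)).hasFDerivAt

/-! ### Smoothness of superposition operators on `C(K, E)`. -/

section Superposition

variable {K : Type*} [TopologicalSpace K] [CompactSpace K]
  {E F : Type} [NormedAddCommGroup E] [NormedSpace ℝ E] [NormedAddCommGroup F] [NormedSpace ℝ F]

/-- Pointwise application of a continuous family of operators to a continuous function. -/
def pointwiseApply : C(K, E →L[ℝ] F) →L[ℝ] C(K, E) →L[ℝ] C(K, F) :=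
  LinearMap.mkContinuous₂
    (LinearMap.mk₂ ℝ
      (fun (A : C(K, E →L[ℝ] F)) (u : C(K, E)) =>
        (⟨fun s => A s (u s), A.continuous.clm_apply u.continuous⟩ : C(K, F)))
      (by intros; ext; simp) (by intros; ext; simp) (by intros; ext; simp) (by intros; ext; simp))
    1 (by
      intro A u
      rw [ContinuousMap.norm_le _ (by positivity)]
      intro s
      rw [one_mul]
      exact ((A s).le_opNorm _).trans
        (mul_le_mul (A.norm_coe_le_norm s) (u.norm_coe_le_norm s) (norm_nonneg _)
          ((norm_nonneg (A s)).trans (A.norm_coe_le_norm s))))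

@[simp]
theorem pointwiseApply_apply (A : C(K, E →L[ℝ] F)) (u : C(K, E)) (s : K) :
    pointwiseApply A u s = A s (u s) := rfl

/-- The derivative of `f` is uniformly continuous around the compact range of `u`, so the mean value
inequality bounds the remainder uniformly in `s`. -/
theorem hasFDerivAt_continuousMap_comp {f : E → F} (hf : ContDiff ℝ 1 f) (u : C(K, E)) :
    HasFDerivAt (fun v : C(K, E) => (⟨f, hf.continuous⟩ : C(E, F)).comp v)
      (pointwiseApply ((⟨fderiv ℝ f, hf.continuous_fderiv (by simp)⟩ : C(E, E →L[ℝ] F)).comp u))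
      u := by
  rw [hasFDerivAt_iff_isLittleO, Asymptotics.isLittleO_iff]
  intro c hc
  have hK : IsCompact (range u) := isCompact_range u.continuous
  have hun := hK.uniformContinuousAt_of_continuousAt (fderiv ℝ f)
    (fun x _ => (hf.continuous_fderiv (by simp)).continuousAt) (Metric.dist_mem_uniformity hc)
  obtain ⟨δ, hδ, h⟩ := Metric.mem_uniformity_dist.1 hun
  filter_upwards [Metric.ball_mem_nhds u hδ] with v hv
  rw [ContinuousMap.norm_le _ (by positivity)]
  intro s
  have hsv : v s ∈ Metric.ball (u s) δ := (ContinuousMap.dist_apply_le_dist s).trans_lt hv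
  have := (convex_ball (u s) δ).norm_image_sub_le_of_norm_hasFDerivWithin_le'
    (f := f) (f' := fderiv ℝ f) (φ := fderiv ℝ f (u s)) (C := c)
    (fun x _ => ((hf.differentiable (by simp)) x).hasFDerivAt.hasFDerivWithinAt)
    (fun x hx => by
      have := h (a := u s) (b := x) (by rwa [dist_comm]) (mem_range_self s)
      rw [← dist_eq_norm, dist_comm]
      exact le_of_lt this)
    (Metric.mem_ball_self hδ) hsv
  refine le_trans ?_ (this.trans ?_)
  · simp
  · exact mul_le_mul_of_nonneg_left ((v - u).norm_coe_le_norm s) hc.le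

/-- The derivative is again a superposition operator, by `fderiv ℝ f`, followed by the continuous
linear `pointwiseApply`. The induction therefore has to let the target `F` vary. -/
theorem contDiff_continuousMap_comp_nat (m : ℕ) :
    ∀ {F : Type} [NormedAddCommGroup F] [NormedSpace ℝ F] {f : E → F} (hf : ContDiff ℝ ∞ f),
    ContDiff ℝ m (fun v : C(K, E) => (⟨f, hf.continuous⟩ : C(E, F)).comp v) := by
  induction m with
  | zero =>
    intro F _ _ f hf
    exact contDiff_zero.2 (ContinuousMap.continuous_postcomp _)
  | succ m ih =>
    intro F _ _ f hf
    have h1 : ContDiff ℝ 1 f := hf.of_le (by simp)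
    rw [show ((m + 1 : ℕ) : WithTop ℕ∞) = m + 1 by norm_cast, contDiff_succ_iff_hasFDerivAt]
    exact ⟨_, pointwiseApply.contDiff.comp (ih (hf.fderiv_right (m := ∞) (by simp))),
      hasFDerivAt_continuousMap_comp h1⟩

/-- Composition with a smooth map is a smooth map between spaces of continuous functions. -/
theorem contDiff_continuousMap_comp {f : E → F} (hf : ContDiff ℝ ∞ f) :
    ContDiff ℝ ∞ (fun v : C(K, E) => (⟨f, hf.continuous⟩ : C(E, F)).comp v) :=
  contDiff_infty.2 fun m => contDiff_continuousMap_comp_nat m hf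

end Superposition

/-! ### Smooth dependence of flows on time and initial point. -/

section Flow

variable {E : Type} [NormedAddCommGroup E] [NormedSpace ℝ E]

/-- The primitive vanishing at `0` of a continuous function on the unit interval. -/
def primitive [CompleteSpace E] : C(Icc (0 : ℝ) 1, E) →L[ℝ] C(Icc (0 : ℝ) 1, E) :=
  LinearMap.mkContinuous
    { toFun := fun u => ⟨fun s => ∫ τ in (0 : ℝ)..s, IccExtend zero_le_one u τ,
        (intervalIntegral.continuous_primitive (fun a b =>
          (u.continuous.Icc_extend').intervalIntegrable a b) 0).comp continuous_subtype_val⟩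
      map_add' := by
        intro u v
        ext s
        exact intervalIntegral.integral_add ((u.continuous.Icc_extend').intervalIntegrable _ _)
          ((v.continuous.Icc_extend').intervalIntegrable _ _)
      map_smul' := by
        intro c u
        ext s
        exact intervalIntegral.integral_smul c _ }
    1 (by
      intro u
      rw [ContinuousMap.norm_le _ (by positivity)]
      intro s
      have := intervalIntegral.norm_integral_le_of_norm_le_const (a := 0) (b := (s : ℝ))
        (f := IccExtend zero_le_one u) (C := ‖u‖) (fun x _ => u.norm_coe_le_norm _)
      refine this.trans ?_
      rw [mul_comm, sub_zero, abs_of_nonneg s.2.1]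
      exact mul_le_mul_of_nonneg_right s.2.2 (norm_nonneg _))

theorem primitive_apply [CompleteSpace E] (u : C(Icc (0 : ℝ) 1, E)) (s : Icc (0 : ℝ) 1) :
    primitive u s = ∫ τ in (0 : ℝ)..s, IccExtend zero_le_one u τ := rfl

/-- Local smooth flow of a globally defined smooth vector field. -/
theorem exists_smooth_flow_of_contDiff [CompleteSpace E] {Y : E → E} (hY : ContDiff ℝ ∞ Y)
    (p : E) : ∃ δ > 0, ∃ Φ : ℝ × E → E,
      ContDiffOn ℝ ∞ Φ (Metric.ball 0 δ ×ˢ Metric.ball p δ) ∧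
      (∀ y ∈ Metric.ball p δ, Φ (0, y) = y) ∧
      ∀ t ∈ Metric.ball (0 : ℝ) δ, ∀ y ∈ Metric.ball p δ,
        HasDerivAt (fun t => Φ (t, y)) (Y (Φ (t, y))) t := by
  obtain ⟨ε, hε, a, r, L, K, hr, hpl⟩ :=
    IsPicardLindelof.of_contDiffAt_one (x₀ := p) (hY.of_le (m := 1) (by simp)).contDiffAt
  obtain ⟨α, hα, hαc⟩ := (hpl 0).exists_forall_mem_closedBall_eq_hasDerivWithinAt_continuousOn
  simp only [zero_sub, zero_add] at hα hαc
  have hαd : ∀ y ∈ Metric.ball p r, ∀ t ∈ Metric.ball (0 : ℝ) ε,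
      HasDerivAt (fun t => α (y, t)) (Y (α (y, t))) t := by
    intro y hy t ht
    rw [Real.ball_eq_Ioo, zero_sub, zero_add] at ht
    exact ((hα y (Metric.ball_subset_closedBall hy)).2 t (Ioo_subset_Icc_self ht)).hasDerivAt
      (Icc_mem_nhds ht.1 ht.2)
  let X := C(Icc (0 : ℝ) 1, E)
  let comp : X → X := fun u => (⟨Y, hY.continuous⟩ : C(E, E)).comp u
  have hcomp : ContDiff ℝ ∞ comp := contDiff_continuousMap_comp hY
  let cst : E →L[ℝ] X := ContinuousLinearMap.const ℝ (Icc (0 : ℝ) 1)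
  -- The rescaled trajectory `c(s) = Φ(ts, y)` solves `c = y + t ∫ Y(c)`, that is, `H ((t, y), c) =
  -- ((t, y), 0)`. Keeping `(t, y)` as coordinates makes a smooth local inverse of `H` give smooth
  -- dependence on `(t, y)`.
  let H : (ℝ × E) × X → (ℝ × E) × X :=
    fun z => (z.1, z.2 - cst z.1.2 - z.1.1 • primitive (comp z.2))
  have hH : ContDiff ℝ ∞ H := by
    have h1 : ContDiff ℝ ∞ fun z : (ℝ × E) × X => primitive (comp z.2) :=
      primitive.contDiff.comp (hcomp.comp contDiff_snd)
    have h2 : ContDiff ℝ ∞ fun z : (ℝ × E) × X => cst z.1.2 :=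
      cst.contDiff.comp (contDiff_snd.comp contDiff_fst)
    exact contDiff_fst.prodMk ((contDiff_snd.sub h2).sub ((contDiff_fst.fst).smul h1))
  let z₀ : (ℝ × E) × X := ((0, p), cst p)
  let B : (ℝ × E) →L[ℝ] X := cst.comp (.snd ℝ ℝ E) +
    (ContinuousLinearMap.fst ℝ ℝ E).smulRight (primitive (comp (cst p)))
  -- At `t = 0` the integral term contributes nothing in the direction of the curve, so the
  -- derivative of `H` is unipotent and is inverted by changing the sign of `B`.
  let e : ((ℝ × E) × X) ≃L[ℝ] ((ℝ × E) × X) := ContinuousLinearEquiv.equivOfInverse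
    ((ContinuousLinearMap.fst ℝ (ℝ × E) X).prod (.snd ℝ (ℝ × E) X - B.comp (.fst ℝ (ℝ × E) X)))
    ((ContinuousLinearMap.fst ℝ (ℝ × E) X).prod (.snd ℝ (ℝ × E) X + B.comp (.fst ℝ (ℝ × E) X)))
    (fun z => by simp) (fun z => by simp)
  have he : HasFDerivAt H (e : ((ℝ × E) × X) →L[ℝ] ((ℝ × E) × X)) z₀ := by
    have h1 : HasFDerivAt (fun z : (ℝ × E) × X => primitive (comp z.2))
        (primitive.comp ((fderiv ℝ comp (cst p)).comp (.snd ℝ (ℝ × E) X))) z₀ :=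
      primitive.hasFDerivAt.comp z₀ (HasFDerivAt.comp (f := Prod.snd) (g := comp) z₀
        ((hcomp.differentiable (by simp)) (cst p)).hasFDerivAt hasFDerivAt_snd)
    have h2 : HasFDerivAt (fun z : (ℝ × E) × X => cst z.1.2)
        (cst.comp ((ContinuousLinearMap.snd ℝ ℝ E).comp (.fst ℝ (ℝ × E) X))) z₀ :=
      cst.hasFDerivAt.comp z₀ (hasFDerivAt_snd.comp z₀ hasFDerivAt_fst)
    have h3 : HasFDerivAt (fun z : (ℝ × E) × X => z.1.1)
        ((ContinuousLinearMap.fst ℝ ℝ E).comp (.fst ℝ (ℝ × E) X)) z₀ :=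
      hasFDerivAt_fst.comp z₀ hasFDerivAt_fst
    refine (hasFDerivAt_fst.prodMk ((hasFDerivAt_snd.sub h2).sub (h3.smul h1))).congr_fderiv ?_
    ext z <;> simp [e, B, z₀]
  obtain ⟨φ, hφ, hz₀, -, -, hφs⟩ :=
    exists_openPartialHomeomorph_contDiffOn isOpen_univ hH.contDiffOn (mem_univ z₀) e he
  obtain ⟨η, hη, hball⟩ := Metric.isOpen_iff.1 φ.open_source z₀ hz₀
  have hα0 : α (p, 0) = p := (hα p (Metric.mem_closedBall_self hr.le)).1
  have hcα : ContinuousAt α (p, 0) := hαc.continuousAt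
    (prod_mem_nhds (Metric.closedBall_mem_nhds p hr) (Icc_mem_nhds (by linarith) hε))
  obtain ⟨δ', hδ', hnear⟩ := Metric.continuousAt_iff.1 hcα (η / 2) (by positivity)
  obtain ⟨δ, hδ, h1, h2, h3, h4⟩ : ∃ δ > 0, δ ≤ δ' ∧ δ ≤ η ∧ δ ≤ ε ∧ δ ≤ r := by
    refine ⟨min (min δ' η) (min ε r), by positivity, ?_, ?_, ?_, ?_⟩ <;> simp
  -- Existence comes from Picard–Lindelöf; these trajectories stay close to the constant curve `p`,
  -- hence lie where `φ` is injective and are recovered by `φ.symm`.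
  have key : ∀ t ∈ Metric.ball (0 : ℝ) δ, ∀ y ∈ Metric.ball p δ,
      ∃ c : X, (∀ s, c s = α (y, t * s)) ∧ ((t, y), c) ∈ φ.source ∧
        H ((t, y), c) = ((t, y), 0) := by
    intro t ht y hy
    have hts : ∀ s ∈ Icc (0 : ℝ) 1, t * s ∈ Metric.ball (0 : ℝ) δ := by
      intro s hs
      rw [mem_ball_zero_iff, norm_mul] at *
      refine lt_of_le_of_lt ?_ ht
      rw [Real.norm_of_nonneg hs.1]
      exact mul_le_of_le_one_right (norm_nonneg _) hs.2
    have hd : ∀ s ∈ Icc (0 : ℝ) 1,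
        HasDerivAt (fun s => α (y, t * s)) (t • Y (α (y, t * s))) s := by
      intro s hs
      have := hαd y (Metric.ball_subset_ball h4 hy) (t * s) (Metric.ball_subset_ball h3 (hts s hs))
      simpa [Function.comp_def] using this.scomp s ((hasDerivAt_id s).const_mul t)
    have hcont : ContinuousOn (fun s => α (y, t * s)) (Icc 0 1) :=
      fun s hs => (hd s hs).continuousAt.continuousWithinAt
    let c : X := ⟨fun s => α (y, t * s), continuousOn_iff_continuous_domRestrict.1 hcont⟩
    refine ⟨c, fun s => rfl, hball ?_, ?_⟩
    · rw [Metric.mem_ball, Prod.dist_eq, Prod.dist_eq, max_lt_iff, max_lt_iff]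
      refine ⟨⟨lt_of_lt_of_le ht h2, lt_of_lt_of_le hy h2⟩, ?_⟩
      refine lt_of_le_of_lt ((ContinuousMap.dist_le (half_pos hη).le).2 fun s => ?_)
        (half_lt_self hη)
      refine (le_of_eq_of_le ?_ (hnear (x := (y, t * s)) ?_).le)
      · rw [hα0]; rfl
      · rw [Prod.dist_eq, max_lt_iff]
        exact ⟨lt_of_lt_of_le hy h1, lt_of_lt_of_le (hts s s.2) h1⟩
    · refine Prod.ext rfl ?_
      ext s
      change α (y, t * s) - y - t • primitive (comp c) s = 0
      have hsub : uIcc 0 (s : ℝ) ⊆ Icc 0 1 := by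
        rw [uIcc_of_le s.2.1]; exact Icc_subset_Icc_right s.2.2
      have hcY : ContinuousOn (fun s => t • Y (α (y, t * s))) (Icc 0 1) :=
        (hY.continuous.comp_continuousOn hcont).const_smul t
      have hint := intervalIntegral.integral_eq_sub_of_hasDerivAt
        (fun τ hτ => hd τ (hsub hτ)) (hcY.mono hsub).intervalIntegrable
      rw [primitive_apply, ← intervalIntegral.integral_smul,
        intervalIntegral.integral_congr (g := fun τ => t • Y (α (y, t * τ))) ?_, hint, mul_zero,
        (hα y (Metric.ball_subset_closedBall (Metric.ball_subset_ball h4 hy))).1, sub_self]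
      intro τ hτ
      change t • IccExtend zero_le_one (comp c) τ = _
      rw [IccExtend_of_mem _ _ (hsub hτ)]
      rfl
  have hone : (1 : ℝ) ∈ Icc (0 : ℝ) 1 := by simp
  have hval : ∀ t ∈ Metric.ball (0 : ℝ) δ, ∀ y ∈ Metric.ball p δ,
      ((t, y), (0 : X)) ∈ φ.target ∧ α (y, t) = (φ.symm ((t, y), 0)).2 ⟨1, hone⟩ := by
    intro t ht y hy
    obtain ⟨c, hc, hcs, hcH⟩ := key t ht y hy
    rw [← hcH, ← hφ]
    refine ⟨φ.map_source hcs, ?_⟩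
    rw [φ.left_inv hcs, hc, mul_one]
  refine ⟨δ, hδ, fun z => α (z.2, z.1), ?_, ?_, ?_⟩
  · have : ContDiffOn ℝ ∞ (fun z : ℝ × E => (φ.symm (z, (0 : X))).2 ⟨1, hone⟩)
        (Metric.ball 0 δ ×ˢ Metric.ball p δ) := by
      have hev : ContDiff ℝ ∞ fun u : X => u ⟨1, hone⟩ :=
        (ContinuousMap.evalCLM (M := E) ℝ (⟨1, hone⟩ : Icc (0 : ℝ) 1)).contDiff
      have hin : ContDiff ℝ ∞ fun z : ℝ × E => (z, (0 : X)) := contDiff_id.prodMk contDiff_const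
      exact (hev.comp contDiff_snd).comp_contDiffOn (hφs.comp hin.contDiffOn
        fun z hz => (hval z.1 hz.1 z.2 hz.2).1)
    exact this.congr fun z hz => (hval z.1 hz.1 z.2 hz.2).2
  · exact fun y hy => (hα y (Metric.ball_subset_closedBall (Metric.ball_subset_ball h4 hy))).1
  · exact fun t ht y hy => hαd y (Metric.ball_subset_ball h4 hy) t (Metric.ball_subset_ball h3 ht)

/-- Local smooth flow of a smooth vector field on an open set. -/
theorem exists_smooth_flow [FiniteDimensional ℝ E] {X : E → E} {U : Set E} (hU : IsOpen U)
    (hX : ContDiffOn ℝ ∞ X U) {p : E} (hp : p ∈ U) : ∃ δ > 0, ∃ Φ : ℝ × E → E,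
      ContDiffOn ℝ ∞ Φ (Metric.ball 0 δ ×ˢ Metric.ball p δ) ∧
      MapsTo Φ (Metric.ball 0 δ ×ˢ Metric.ball p δ) U ∧
      (∀ y ∈ Metric.ball p δ, Φ (0, y) = y) ∧
      ∀ t ∈ Metric.ball (0 : ℝ) δ, ∀ y ∈ Metric.ball p δ,
        HasDerivAt (fun t => Φ (t, y)) (X (Φ (t, y))) t := by
  have : CompleteSpace E := FiniteDimensional.complete ℝ E
  obtain ⟨ρ, hρ, hρU⟩ := Metric.isOpen_iff.1 hU p hp
  -- The cutoff makes `χ • X` globally smooth, since its support lies in the ball of radius `ρ`. It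
  -- equals `1` on the ball of radius `ρ / 3`, where short trajectories remain.
  let χ : ContDiffBump p := ⟨ρ / 3, ρ / 2, by positivity, by linarith⟩
  have hY : ContDiff ℝ ∞ fun x => χ x • X x := by
    rw [contDiff_iff_contDiffAt]
    intro x
    by_cases hx : x ∈ Metric.ball p ρ
    · exact χ.contDiff.contDiffAt.smul (hX.contDiffAt (hU.mem_nhds (hρU hx)))
    · have hx' : x ∉ tsupport χ := by
        rw [χ.tsupport_eq]
        simp only [Metric.mem_ball, Metric.mem_closedBall, not_lt, not_le] at hx ⊢
        change ρ / 2 < dist x p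
        linarith
      refine contDiffAt_const (c := (0 : E)) |>.congr_of_eventuallyEq ?_
      filter_upwards [notMem_tsupport_iff_eventuallyEq.1 hx'] with y hy
      simp [hy]
  obtain ⟨δ, hδ, Φ, hΦ, hΦ0, hΦd⟩ := exists_smooth_flow_of_contDiff hY p
  have hc : ContinuousAt Φ (0, p) := hΦ.continuousOn.continuousAt
    (prod_mem_nhds (Metric.ball_mem_nhds 0 hδ) (Metric.ball_mem_nhds p hδ))
  obtain ⟨δ', hδ', hnear⟩ := Metric.continuousAt_iff.1 hc (ρ / 3) (by positivity)
  have hsub := Metric.ball_subset_ball (x := (0 : ℝ)) (min_le_left δ δ')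
  have hsub' := Metric.ball_subset_ball (x := p) (min_le_left δ δ')
  have hmem : ∀ t ∈ Metric.ball (0 : ℝ) (min δ δ'), ∀ y ∈ Metric.ball p (min δ δ'),
      Φ (t, y) ∈ Metric.ball p (ρ / 3) := by
    intro t ht y hy
    have := hnear (x := (t, y)) (by
      rw [Prod.dist_eq, max_lt_iff]
      exact ⟨ht.trans_le (min_le_right _ _), hy.trans_le (min_le_right _ _)⟩)
    rwa [hΦ0 p (Metric.mem_ball_self hδ)] at this
  refine ⟨min δ δ', by positivity, Φ, hΦ.mono (prod_mono hsub hsub'), ?_,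
    fun y hy => hΦ0 y (hsub' hy), fun t ht y hy => ?_⟩
  · exact fun z hz => hρU (Metric.ball_subset_ball (by linarith) (hmem z.1 hz.1 z.2 hz.2))
  · have := hΦd t (hsub ht) y (hsub' hy)
    rwa [χ.one_of_mem_closedBall (Metric.ball_subset_closedBall (hmem t ht y hy)), one_smul] at this

end Flow

/-! ### Kernels of constant rank families and radicals of restricted bilinear forms. -/

section LinearAlgebra

/-- Every linear map has a generalized inverse. -/
theorem exists_generalizedInverse {V W : Type*} [AddCommGroup V] [Module ℝ V] [AddCommGroup W]
    [Module ℝ W] (T : V →ₗ[ℝ] W) : ∃ B : W →ₗ[ℝ] V, ∀ v, T (B (T v)) = T v := by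
  obtain ⟨S, hS⟩ := T.rangeRestrict.exists_rightInverse_of_surjective T.range_rangeRestrict
  obtain ⟨B, hB⟩ := LinearMap.exists_extend S
  refine ⟨B, fun v => ?_⟩
  have h1 : B (T v) = S (T.rangeRestrict v) := LinearMap.congr_fun hB (T.rangeRestrict v)
  have h2 := LinearMap.congr_fun hS (T.rangeRestrict v)
  rw [h1]
  exact congrArg Subtype.val h2

/-- A vector in the kernel of a member of a smooth constant rank family of linear maps extends
locally to a smooth section of the kernels. -/
theorem exists_smooth_section_ker {E V W : Type*} [NormedAddCommGroup E] [NormedSpace ℝ E]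
    [NormedAddCommGroup V] [NormedSpace ℝ V] [FiniteDimensional ℝ V]
    [NormedAddCommGroup W] [NormedSpace ℝ W] [FiniteDimensional ℝ W]
    {T : E → V →L[ℝ] W} {U : Set E} (hU : IsOpen U) (hT : ContDiffOn ℝ ∞ T U) {k : ℕ}
    (hk : ∀ x ∈ U, Module.finrank ℝ (LinearMap.ker (T x : V →ₗ[ℝ] W)) = k) {p : E} (hp : p ∈ U)
    {v₀ : V} (hv₀ : T p v₀ = 0) :
    ∃ U' ⊆ U, IsOpen U' ∧ p ∈ U' ∧ ∃ v : E → V, ContDiffOn ℝ ∞ v U' ∧ v p = v₀ ∧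
      ∀ x ∈ U', T x (v x) = 0 := by
  have : CompleteSpace V := FiniteDimensional.complete ℝ V
  obtain ⟨B₀, hB₀⟩ := exists_generalizedInverse (T p : V →ₗ[ℝ] W)
  let B : W →L[ℝ] V := LinearMap.toContinuousLinearMap B₀
  have hB : ∀ v, T p (B (T p v)) = T p v := hB₀
  -- Since `T p ∘ B ∘ T p = T p`, the operator `N x` maps `ker (T x)` into `ker (T p)`. It is
  -- invertible near `p`, and the kernels have equal dimension, so `(N x)⁻¹ v₀` lies in `ker (T x)`.
  let N : E → V →L[ℝ] V := fun x => 1 - B.comp (T p) + B.comp (T x)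
  have hN : ContDiffOn ℝ ∞ N U := contDiffOn_const.add (contDiffOn_const.clm_comp hT)
  have hNp : N p = 1 := by simp [N]
  refine ⟨U ∩ N ⁻¹' {A | IsUnit A}, inter_subset_left,
    hN.continuousOn.isOpen_inter_preimage hU Units.isOpen, ⟨hp, by simp [hNp]⟩,
    fun x => Ring.inverse (N x) v₀, ?_, by simp [hNp], ?_⟩
  · intro x hx
    obtain ⟨u, hu⟩ := hx.2
    have h1 : ContDiffAt ℝ ∞ Ring.inverse (N x) := hu ▸ contDiffAt_ringInverse ℝ u
    exact ((h1.comp x (hN.contDiffAt (hU.mem_nhds hx.1))).clm_apply contDiffAt_const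
      ).contDiffWithinAt
  · intro x hx
    have hinv : ∀ v, Ring.inverse (N x) (N x v) = v :=
      fun v => DFunLike.congr_fun (Ring.inverse_mul_cancel _ hx.2) v
    have hinj : Function.Injective (N x) := by
      intro v w hvw
      rw [← hinv v, hvw, hinv]
    have hmaps : ∀ v ∈ LinearMap.ker (T x : V →ₗ[ℝ] W), (N x : V →ₗ[ℝ] V) v ∈
        LinearMap.ker (T p : V →ₗ[ℝ] W) := by
      intro v hv
      have hv' : T x v = 0 := hv
      change T p (N x v) = 0
      simp [N, hv', hB]
    let R := (N x : V →ₗ[ℝ] V).restrict hmaps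
    have hR : Function.Injective R := by
      intro v w hvw
      exact Subtype.ext (hinj (congrArg Subtype.val hvw))
    have hsurj := (LinearMap.injective_iff_surjective_of_finrank_eq_finrank
      ((hk x hx.1).trans (hk p hp).symm)).1 hR
    obtain ⟨v, hv⟩ := hsurj ⟨v₀, hv₀⟩
    have hv' : N x v = v₀ := congrArg Subtype.val hv
    change T x (Ring.inverse (N x) v₀) = 0
    rw [← hv', hinv]
    exact v.2

variable {V W : Type*} [AddCommGroup V] [Module ℝ V] [FiniteDimensional ℝ V]
  [AddCommGroup W] [Module ℝ W]

/-- Restricting functionals to `W` turns the isomorphism `Ω` onto the dual into a surjection onto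
the dual of `W`. Its kernel is the orthogonal of `j(W)`, which by coisotropy is the radical of the
restriction; rank-nullity gives the count. -/
theorem finrank_ker_compl₁₂_of_orthogonal_le (Ω : V →ₗ[ℝ] V →ₗ[ℝ] ℝ) (hΩ : Function.Injective Ω)
    (j : W →ₗ[ℝ] V) (hj : Function.Injective j)
    (h : ∀ v, (∀ w, Ω v (j w) = 0) → v ∈ LinearMap.range j) :
    Module.finrank ℝ (LinearMap.ker (Ω.compl₁₂ j j)) + Module.finrank ℝ W =
      Module.finrank ℝ V := by
  let Ψ : V →ₗ[ℝ] Module.Dual ℝ W := j.dualMap.comp Ω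
  have hΩs : Function.Surjective Ω :=
    (LinearMap.injective_iff_surjective_of_finrank_eq_finrank
      (Subspace.dual_finrank_eq (K := ℝ) (V := V)).symm).1 hΩ
  have hΨs : Function.Surjective Ψ :=
    (LinearMap.dualMap_surjective_of_injective hj).comp hΩs
  have hker : LinearMap.ker Ψ = (LinearMap.ker (Ω.compl₁₂ j j)).map j := by
    ext v
    rw [Submodule.mem_map]
    constructor
    · intro hv
      have hv' : ∀ w, Ω v (j w) = 0 := fun w => LinearMap.congr_fun hv w
      obtain ⟨w, rfl⟩ := h v hv'
      exact ⟨w, LinearMap.ext hv', rfl⟩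
    · rintro ⟨w, hw, rfl⟩
      exact LinearMap.ext fun w' => LinearMap.congr_fun hw w'
  have hrn := LinearMap.finrank_range_add_finrank_ker Ψ
  rw [hker, ← (Submodule.equivMapOfInjective j hj _).finrank_eq, LinearMap.range_eq_top.2 hΨs, finrank_top,
    Subspace.dual_finrank_eq] at hrn
  omega

theorem exists_eq_smul_of_ker_le {V : Type*} [AddCommGroup V] [Module ℝ V] (ℓ f : V →ₗ[ℝ] ℝ)
    (hℓ : ℓ ≠ 0) (h : ∀ v, ℓ v = 0 → f v = 0) :
    ∃ c : ℝ, f = c • ℓ := by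
  obtain ⟨v, hv⟩ : ∃ v, ℓ v ≠ 0 := by
    by_contra! hc
    exact hℓ (LinearMap.ext hc)
  refine ⟨f v / ℓ v, LinearMap.ext fun w => ?_⟩
  have := h (w - (ℓ w / ℓ v) • v) (by simp [hv])
  rw [map_sub, map_smul, smul_eq_mul, sub_eq_zero] at this
  rw [this, LinearMap.smul_apply, smul_eq_mul]
  ring

/-- Hyperplanes are coisotropic: if `v` is orthogonal to `ker ℓ`, then `Ω v = c ℓ`, and `Ω v v = 0`
forces `c = 0`, hence `v = 0`, or `ℓ v = 0`. -/
theorem finrank_ker_compl₁₂_hyperplane_of_injective (Ω : V →ₗ[ℝ] V →ₗ[ℝ] ℝ)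
    (halt : ∀ v, Ω v v = 0) (hΩ : Function.Injective Ω) (j : W →ₗ[ℝ] V)
    (hj : Function.Injective j) (ℓ : V →ₗ[ℝ] ℝ) (hℓ : ℓ ≠ 0)
    (hjℓ : ∀ v, ℓ v = 0 ↔ v ∈ LinearMap.range j) :
    Module.finrank ℝ (LinearMap.ker (Ω.compl₁₂ j j)) + Module.finrank ℝ W =
      Module.finrank ℝ V := by
  refine finrank_ker_compl₁₂_of_orthogonal_le Ω hΩ j hj fun v hv => ?_
  obtain ⟨c, hc⟩ := exists_eq_smul_of_ker_le ℓ (Ω v) hℓ (by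
    intro w hw
    obtain ⟨w', rfl⟩ := (hjℓ w).1 hw
    exact hv w')
  rw [← hjℓ]
  rcases eq_or_ne c 0 with rfl | hc0
  · rw [zero_smul] at hc
    have : v = 0 := hΩ (by rw [hc, map_zero])
    rw [this, map_zero]
  · have := halt v
    rw [hc, LinearMap.smul_apply, smul_eq_mul] at this
    exact (mul_eq_zero.1 this).resolve_left hc0

/-- Because `X` is radical and spans a complement of the hyperplane, the radical of the restriction
is the radical of `Ω` intersected with `ker ℓ`; `X` shows that this intersection has codimension
one. -/
theorem finrank_ker_compl₁₂_hyperplane_of_mem_ker (Ω : V →ₗ[ℝ] V →ₗ[ℝ] ℝ)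
    (halt : ∀ v, Ω v v = 0) (j : W →ₗ[ℝ] V)
    (hj : Function.Injective j) (ℓ : V →ₗ[ℝ] ℝ)
    (hjℓ : ∀ v, ℓ v = 0 ↔ v ∈ LinearMap.range j) {X : V} (hX : Ω X = 0) (hXℓ : ℓ X ≠ 0) :
    Module.finrank ℝ (LinearMap.ker (Ω.compl₁₂ j j)) + 1 =
      Module.finrank ℝ (LinearMap.ker Ω) := by
  have hskew : ∀ v w, Ω v w = - Ω w v := by
    intro v w
    have := halt (v + w)
    simp only [map_add, LinearMap.add_apply, halt] at this
    linarith
  let r : LinearMap.ker Ω →ₗ[ℝ] ℝ := ℓ.comp (LinearMap.ker Ω).subtype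
  have hrs : LinearMap.range r = ⊤ := by
    rw [LinearMap.range_eq_top]
    apply LinearMap.surjective
    intro h0
    exact hXℓ (LinearMap.congr_fun h0 ⟨X, hX⟩)
  have hrn := LinearMap.finrank_range_add_finrank_ker r
  rw [hrs, finrank_top, Module.finrank_self] at hrn
  have hmap : (LinearMap.ker (Ω.compl₁₂ j j)).map j =
      (LinearMap.ker r).map (LinearMap.ker Ω).subtype := by
    ext v
    simp only [Submodule.mem_map]
    constructor
    · rintro ⟨w, hw, rfl⟩
      have hw' : ∀ w', Ω (j w) (j w') = 0 := fun w' => LinearMap.congr_fun hw w'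
      have hkw : Ω (j w) = 0 := by
        ext u
        obtain ⟨w', hw''⟩ := (hjℓ (u - (ℓ u / ℓ X) • X)).1 (by simp [hXℓ])
        have h2 := hw' w'
        rw [hw'', map_sub, map_smul, hskew (j w) X, hX] at h2
        simpa using h2
      exact ⟨⟨j w, hkw⟩, (hjℓ _).2 ⟨w, rfl⟩, rfl⟩
    · rintro ⟨⟨u, hu⟩, hru, rfl⟩
      obtain ⟨w, hw⟩ := (hjℓ u).1 hru
      refine ⟨w, ?_, hw⟩
      rw [LinearMap.mem_ker] at hu ⊢
      ext w'
      simp [hw, hu]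
  have h1 := (Submodule.equivMapOfInjective j hj (LinearMap.ker (Ω.compl₁₂ j j))).finrank_eq
  have h2 := (Submodule.equivMapOfInjective (LinearMap.ker Ω).subtype
    (LinearMap.ker Ω).injective_subtype (LinearMap.ker r)).finrank_eq
  rw [hmap] at h1
  omega

end LinearAlgebra

/-! ### Exterior derivatives, symplectization and restriction to affine subspaces. -/

section Forms

variable {E F : Type*} [NormedAddCommGroup E] [NormedSpace ℝ E]
  [NormedAddCommGroup F] [NormedSpace ℝ F]

/-- The exterior derivative of a `1`-form on a normed space. -/
def formDeriv (a : E → E →L[ℝ] ℝ) (x v w : E) : ℝ :=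
  fderiv ℝ a x v w - fderiv ℝ a x w v

theorem formDeriv_congr {a b : E → E →L[ℝ] ℝ} {x : E} (h : a =ᶠ[𝓝 x] b) (v w : E) :
    formDeriv a x v w = formDeriv b x v w := by
  rw [formDeriv, formDeriv, h.fderiv_eq]

/-- The exterior derivative commutes with pullbacks. -/
theorem formDeriv_pullback {a : F → F →L[ℝ] ℝ} {f : E → F} {x : E} (hf : ContDiffAt ℝ 2 f x)
    (ha : DifferentiableAt ℝ a (f x)) (v w : E) :
    formDeriv (fun y => (a (f y)).comp (fderiv ℝ f y)) x v w =
      formDeriv a (f x) (fderiv ℝ f x v) (fderiv ℝ f x w) := by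
  have h1 : HasFDerivAt f (fderiv ℝ f x) x := (hf.differentiableAt (by simp)).hasFDerivAt
  have h2 : HasFDerivAt (fderiv ℝ f) (fderiv ℝ (fderiv ℝ f) x) x :=
    ((hf.fderiv_right (m := 1) (by norm_num)).differentiableAt (by simp)).hasFDerivAt
  have h3 : HasFDerivAt (fun y => a (f y)) ((fderiv ℝ a (f x)).comp (fderiv ℝ f x)) x :=
    ha.hasFDerivAt.comp x h1
  -- The second derivatives of `f` cancel in the antisymmetrization.
  have hsymm := (hf.isSymmSndFDerivAt (by simp)).eq v w
  rw [formDeriv, formDeriv, (h3.clm_comp h2).fderiv]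
  simp [hsymm]

/-- The bilinear form `da + ds ∧ a` on `E × ℝ`. -/
def symplectization (a : E → E →L[ℝ] ℝ) (x : E) : E × ℝ →L[ℝ] E × ℝ →L[ℝ] ℝ :=
  (fderiv ℝ a x - (fderiv ℝ a x).flip).bilinearComp (.fst ℝ E ℝ) (.fst ℝ E ℝ) +
    ((ContinuousLinearMap.snd ℝ E ℝ).smulRight ((a x).comp (.fst ℝ E ℝ)) -
      ((a x).comp (.fst ℝ E ℝ)).smulRight (ContinuousLinearMap.snd ℝ E ℝ))

theorem symplectization_apply (a : E → E →L[ℝ] ℝ) (x : E) (v w : E × ℝ) :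
    symplectization a x v w =
      formDeriv a x v.1 w.1 + (v.2 * a x w.1 - a x v.1 * w.2) := by
  simp [symplectization, formDeriv]

theorem symplectization_self (a : E → E →L[ℝ] ℝ) (x : E) (v : E × ℝ) :
    symplectization a x v v = 0 := by
  rw [symplectization_apply, formDeriv]
  ring

/-- Pairing with `(0, 1)` and with `(w, 0)` separates the two conditions. They say that the
`E`-component of a radical vector is an infinitesimal symmetry of `ker a` lying in `ker a`. -/
theorem symplectization_eq_zero_iff (a : E → E →L[ℝ] ℝ) (x : E) (v : E × ℝ) :
    symplectization a x v = 0 ↔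
      a x v.1 = 0 ∧ ∀ w, formDeriv a x v.1 w = - (v.2 * a x w) := by
  constructor
  · intro h
    constructor
    · have := DFunLike.congr_fun h (0, 1)
      rw [symplectization_apply] at this
      simpa [formDeriv] using this
    · intro w
      have := DFunLike.congr_fun h (w, 0)
      rw [symplectization_apply] at this
      simp at this
      linarith
  · rintro ⟨h1, h2⟩
    ext w <;> simp [symplectization_apply, h1, h2]

theorem contDiffOn_symplectization [FiniteDimensional ℝ E] {a : E → E →L[ℝ] ℝ} {U : Set E}
    (hU : IsOpen U) (ha : ContDiffOn ℝ ∞ a U) : ContDiffOn ℝ ∞ (symplectization a) U := by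
  have hd : ContDiffOn ℝ ∞ (fderiv ℝ a) U := ha.fderiv_of_isOpen hU (by simp)
  rw [contDiffOn_clm_apply]
  intro v
  rw [contDiffOn_clm_apply]
  intro w
  simp only [symplectization_apply, formDeriv]
  have h1 : ∀ u u' : E, ContDiffOn ℝ ∞ (fun x => fderiv ℝ a x u u') U := fun u u' =>
    (hd.clm_apply contDiffOn_const).clm_apply contDiffOn_const
  have h2 : ∀ u : E, ContDiffOn ℝ ∞ (fun x => a x u) U := fun u => ha.clm_apply contDiffOn_const
  exact ((h1 _ _).sub (h1 _ _)).add ((contDiffOn_const.mul (h2 _)).sub ((h2 _).mul contDiffOn_const))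

/-- The radical of the symplectization. -/
def symplRadical (a : E → E →L[ℝ] ℝ) (x : E) : Submodule ℝ (E × ℝ) :=
  LinearMap.ker (symplectization a x : E × ℝ →ₗ[ℝ] E × ℝ →L[ℝ] ℝ)

theorem mem_symplRadical {a : E → E →L[ℝ] ℝ} {x : E} {v : E × ℝ} :
    v ∈ symplRadical a x ↔ symplectization a x v = 0 := Iff.rfl

theorem symplRadical_eq_ker (a : E → E →L[ℝ] ℝ) (x : E) :
    symplRadical a x = LinearMap.ker (symplectization a x).toLinearMap₁₂ := by
  ext v
  rw [mem_symplRadical, LinearMap.mem_ker]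
  constructor
  · intro h
    ext w <;> simp [h]
  · intro h
    ext w
    · exact LinearMap.congr_fun h _
    · exact LinearMap.congr_fun h _

/-- The restriction of a `1`-form to the affine subspace `p + H`. -/
def restrictForm (a : E → E →L[ℝ] ℝ) (p : E) (H : Submodule ℝ E) (h : H) : H →L[ℝ] ℝ :=
  (a (p + h)).comp H.subtypeL

theorem formDeriv_restrictForm {a : E → E →L[ℝ] ℝ} {p : E} {H : Submodule ℝ E} {h : H}
    (ha : DifferentiableAt ℝ a (p + h)) (v w : H) :
    formDeriv (restrictForm a p H) h v w = formDeriv a (p + h) v w := by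
  have hf : ∀ y : H, HasFDerivAt (fun y : H => p + (y : E)) H.subtypeL y := fun y =>
    H.subtypeL.hasFDerivAt.const_add p
  have hc : ContDiff ℝ 2 fun y : H => p + (y : E) := contDiff_const.add H.subtypeL.contDiff
  have := formDeriv_pullback (f := fun y : H => p + (y : E)) hc.contDiffAt ha v w
  simp only [(hf _).fderiv] at this
  exact this

theorem contDiffOn_restrictForm {a : E → E →L[ℝ] ℝ} {U : Set E} (ha : ContDiffOn ℝ ∞ a U) (p : E)
    (H : Submodule ℝ E) : ContDiffOn ℝ ∞ (restrictForm a p H) {h | p + (h : E) ∈ U} := by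
  have hc : ContDiff ℝ ∞ fun y : H => p + (y : E) := contDiff_const.add H.subtypeL.contDiff
  exact (ha.comp hc.contDiffOn fun x hx => hx).clm_comp contDiffOn_const

theorem symplectization_restrictForm {a : E → E →L[ℝ] ℝ} {p : E} {H : Submodule ℝ E} {h : H}
    (ha : DifferentiableAt ℝ a (p + h)) :
    (symplectization (restrictForm a p H) h).toLinearMap₁₂ =
      (symplectization a (p + h)).toLinearMap₁₂.compl₁₂
        (H.subtype.prodMap (LinearMap.id (R := ℝ) (M := ℝ)))
        (H.subtype.prodMap (LinearMap.id (R := ℝ) (M := ℝ))) := by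
  refine LinearMap.ext fun v => LinearMap.ext fun w => ?_
  change symplectization (restrictForm a p H) h v w =
    symplectization a (p + h) (v.1, v.2) (w.1, w.2)
  rw [symplectization_apply, symplectization_apply, formDeriv_restrictForm ha]
  rfl

end Forms

/-! ### Invariance of `ker a` under characteristic flows. -/

section FlowKernel

variable {E : Type*} [NormedAddCommGroup E] [NormedSpace ℝ E]

/-- Along the flow of a characteristic vector field the values of `a` satisfy a linear equation. -/
theorem hasDerivAt_form_along_flow {a : E → E →L[ℝ] ℝ} {X : E → E} {Φ : ℝ × E → E} {s : ℝ} {y : E}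
    (hΦ : ContDiffAt ℝ 2 Φ (s, y)) (ha : DifferentiableAt ℝ a (Φ (s, y)))
    (hX : DifferentiableAt ℝ X (Φ (s, y)))
    (hΦt : ∀ᶠ z in 𝓝 (s, y), fderiv ℝ Φ z (1, 0) = X (Φ z))
    (hXa : ∀ᶠ x in 𝓝 (Φ (s, y)), a x (X x) = 0) {c : ℝ}
    (hXc : ∀ w, formDeriv a (Φ (s, y)) (X (Φ (s, y))) w = c * a (Φ (s, y)) w) (w : E) :
    HasDerivAt (fun s => a (Φ (s, y)) (fderiv ℝ Φ (s, y) (0, w)))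
      (c * a (Φ (s, y)) (fderiv ℝ Φ (s, y) (0, w))) s := by
  have hcurve : HasDerivAt (fun s => ((s, y) : ℝ × E)) (1, 0) s :=
    (hasDerivAt_id s).prodMk (hasDerivAt_const s y)
  have hΦd : HasFDerivAt Φ (fderiv ℝ Φ (s, y)) (s, y) :=
    (hΦ.differentiableAt (by simp)).hasFDerivAt
  have hDD : HasFDerivAt (fderiv ℝ Φ) (fderiv ℝ (fderiv ℝ Φ) (s, y)) (s, y) :=
    ((hΦ.fderiv_right (m := 1) (by norm_num)).differentiableAt (by simp)).hasFDerivAt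
  have hsymm : fderiv ℝ (fderiv ℝ Φ) (s, y) (1, 0) (0, w) =
      fderiv ℝ (fderiv ℝ Φ) (s, y) (0, w) (1, 0) :=
    (hΦ.isSymmSndFDerivAt (by simp)).eq _ _
  generalize fderiv ℝ (fderiv ℝ Φ) (s, y) = D at hDD hsymm
  have had := ha.hasFDerivAt
  have hXd := hX.hasFDerivAt
  have h1 : HasDerivAt (fun s => a (Φ (s, y)))
      (fderiv ℝ a (Φ (s, y)) (X (Φ (s, y)))) s := by
    have := had.comp_hasDerivAt s (hΦd.comp_hasDerivAt s hcurve)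
    rwa [hΦt.self_of_nhds] at this
  have h2 : HasDerivAt (fun s => fderiv ℝ Φ (s, y) (0, w)) (D (1, 0) (0, w)) s :=
    ((ContinuousLinearMap.apply ℝ E ((0, w) : ℝ × E)).hasFDerivAt.comp_hasDerivAt s
      (hDD.comp_hasDerivAt s hcurve))
  -- The variational equation: `∂_t Φ = X ∘ Φ` differentiated in the direction `w`.
  have h3 : D (0, w) (1, 0) = fderiv ℝ X (Φ (s, y)) (fderiv ℝ Φ (s, y) (0, w)) := by
    have h4 : HasFDerivAt (fun z => fderiv ℝ Φ z (1, 0))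
        ((fderiv ℝ X (Φ (s, y))).comp (fderiv ℝ Φ (s, y))) (s, y) :=
      (hXd.comp (s, y) hΦd).congr_of_eventuallyEq hΦt
    have h5 : HasFDerivAt (fun z => fderiv ℝ Φ z (1, 0))
        ((ContinuousLinearMap.apply ℝ E ((1, 0) : ℝ × E)).comp D) (s, y) :=
      (ContinuousLinearMap.apply ℝ E ((1, 0) : ℝ × E)).hasFDerivAt.comp (s, y) hDD
    exact DFunLike.congr_fun (h5.unique h4) (0, w)
  rw [hsymm, h3] at h2
  set W := fderiv ℝ Φ (s, y) (0, w)
  -- Differentiating `a(X) = 0` along `W` replaces `a(DX W)` by `-(D_W a)(X)`, so the derivative of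
  -- `a(W)` becomes `da(X, W) = c a(W)`.
  have h6 : fderiv ℝ a (Φ (s, y)) W (X (Φ (s, y))) + a (Φ (s, y)) (fderiv ℝ X (Φ (s, y)) W) = 0 := by
    have h8 : HasFDerivAt (fun x => a x (X x)) (0 : E →L[ℝ] ℝ) (Φ (s, y)) :=
      (hasFDerivAt_const (0 : ℝ) _).congr_of_eventuallyEq hXa
    have := DFunLike.congr_fun ((had.clm_apply hXd).unique h8) W
    simp at this
    linarith
  refine (h1.clm_apply h2).congr_deriv ?_
  have h9 := hXc W
  rw [formDeriv] at h9
  linarith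

/-- The flow of a vector field in the characteristic distribution of `a` preserves `ker a`. -/
theorem flow_preserves_ker {a : E → E →L[ℝ] ℝ} {U : Set E} (hU : IsOpen U)
    (ha : ContDiffOn ℝ ∞ a U) {X : E → E} (hX : ContDiffOn ℝ ∞ X U) {c : E → ℝ}
    (hc : ContinuousOn c U) (hXa : ∀ x ∈ U, a x (X x) = 0)
    (hXc : ∀ x ∈ U, ∀ w, formDeriv a x (X x) w = c x * a x w)
    {p : E} {δ : ℝ} {Φ : ℝ × E → E}
    (hΦ : ContDiffOn ℝ ∞ Φ (Metric.ball 0 δ ×ˢ Metric.ball p δ))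
    (hΦU : MapsTo Φ (Metric.ball 0 δ ×ˢ Metric.ball p δ) U)
    (hΦ0 : ∀ y ∈ Metric.ball p δ, Φ (0, y) = y)
    (hΦd : ∀ t ∈ Metric.ball (0 : ℝ) δ, ∀ y ∈ Metric.ball p δ,
      HasDerivAt (fun t => Φ (t, y)) (X (Φ (t, y))) t)
    {t : ℝ} (ht : t ∈ Metric.ball (0 : ℝ) δ) {y : E} (hy : y ∈ Metric.ball p δ) {w : E}
    (hw : a y w = 0) :
    a (Φ (t, y)) (fderiv ℝ Φ (t, y) (0, w)) = 0 := by
  have hD : IsOpen (Metric.ball (0 : ℝ) δ ×ˢ Metric.ball p δ) := Metric.isOpen_ball.prod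
    Metric.isOpen_ball
  have hΦa : ∀ z ∈ Metric.ball (0 : ℝ) δ ×ˢ Metric.ball p δ, ContDiffAt ℝ ∞ Φ z :=
    fun z hz => hΦ.contDiffAt (hD.mem_nhds hz)
  have hΦf : ∀ z ∈ Metric.ball (0 : ℝ) δ ×ˢ Metric.ball p δ, HasFDerivAt Φ (fderiv ℝ Φ z) z :=
    fun z hz => ((hΦa z hz).differentiableAt (by simp)).hasFDerivAt
  have hΦt : ∀ z ∈ Metric.ball (0 : ℝ) δ ×ˢ Metric.ball p δ, fderiv ℝ Φ z (1, 0) = X (Φ z) := by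
    rintro ⟨s, x⟩ hz
    have h1 : HasDerivAt (fun s => ((s, x) : ℝ × E)) (1, 0) s :=
      (hasDerivAt_id s).prodMk (hasDerivAt_const s x)
    exact ((hΦf _ hz).comp_hasDerivAt s h1).unique (hΦd s hz.1 x hz.2)
  let b : ℝ → ℝ := fun t => a (Φ (t, y)) (fderiv ℝ Φ (t, y) (0, w))
  have hb : ∀ s ∈ Metric.ball (0 : ℝ) δ, HasDerivAt b (c (Φ (s, y)) * b s) s := by
    intro s hs
    have hz : (s, y) ∈ Metric.ball (0 : ℝ) δ ×ˢ Metric.ball p δ := ⟨hs, hy⟩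
    have hx := hΦU hz
    exact hasDerivAt_form_along_flow ((hΦa _ hz).of_le ENat.LEInfty.out)
      ((ha.contDiffAt (hU.mem_nhds hx)).differentiableAt (by simp))
      ((hX.contDiffAt (hU.mem_nhds hx)).differentiableAt (by simp))
      (eventually_of_mem (hD.mem_nhds hz) hΦt) (eventually_of_mem (hU.mem_nhds hx) hXa)
      (hXc _ hx) w
  obtain ⟨r, hr1, hr2⟩ := exists_between (mem_ball_zero_iff.1 ht)
  have hr0 : 0 < r := (norm_nonneg t).trans_lt hr1
  have hIcc : Icc (-r) r ⊆ Metric.ball 0 δ := by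
    intro s hs
    rw [mem_ball_zero_iff, Real.norm_eq_abs]
    exact (abs_le.2 hs).trans_lt hr2
  have hcc : ContinuousOn (fun s => c (Φ (s, y))) (Icc (-r) r) :=
    hc.comp (hΦ.continuousOn.comp (by fun_prop) fun s hs => ⟨hIcc hs, hy⟩)
      fun s hs => hΦU ⟨hIcc hs, hy⟩
  obtain ⟨K, hK⟩ := isCompact_Icc.exists_bound_of_continuousOn hcc
  -- The function `b` solves the linear equation `b' = c b` with `b(0) = a y w = 0`, so it agrees
  -- with the zero solution. The Lipschitz constant is a bound of `c` along the trajectory on the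
  -- compact interval `[-r, r]`.
  have huniq := ODE_solution_unique_of_mem_Icc (v := fun s z => c (Φ (s, y)) * z)
    (s := fun _ => univ) (K := K.toNNReal) (f := b) (g := fun _ => 0) (a := -r) (b := r) (t₀ := 0)
    (fun s hs => LipschitzWith.lipschitzOnWith (LipschitzWith.of_dist_le_mul fun z z' => by
      rw [Real.dist_eq, Real.dist_eq, ← mul_sub, abs_mul]
      exact mul_le_mul_of_nonneg_right
        ((hK s (Ioo_subset_Icc_self hs)).trans (Real.le_coe_toNNReal K)) (abs_nonneg _)))
    ⟨by linarith, hr0⟩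
    (fun s hs => (hb s (hIcc hs)).continuousAt.continuousWithinAt)
    (fun s hs => hb s (hIcc (Ioo_subset_Icc_self hs))) (fun _ _ => mem_univ _)
    continuousOn_const (fun s _ => by simpa using hasDerivAt_const s (0 : ℝ))
    (fun _ _ => mem_univ _) (by
      have h0 : (0 : ℝ) ∈ Metric.ball (0 : ℝ) δ := hIcc ⟨by linarith, hr0.le⟩
      have hid : fderiv ℝ Φ (0, y) (0, w) = w := by
        have h1 : HasFDerivAt (fun y => Φ (0, y))
            ((fderiv ℝ Φ (0, y)).comp (.inr ℝ ℝ E)) y :=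
          (hΦf (0, y) ⟨h0, hy⟩).comp y (hasFDerivAt_prodMk_right 0 y)
        have h2 : HasFDerivAt (fun y => Φ (0, y)) (.id ℝ E) y := by
          refine (hasFDerivAt_id y).congr_of_eventuallyEq ?_
          filter_upwards [Metric.isOpen_ball.mem_nhds hy] with z hz using hΦ0 z hz
        simpa using DFunLike.congr_fun (h1.unique h2) w
      change a (Φ (0, y)) (fderiv ℝ Φ (0, y) (0, w)) = 0
      rw [hΦ0 y hy, hid, hw])
  rw [Real.norm_eq_abs] at hr1
  exact huniq (abs_le.1 hr1.le)

end FlowKernel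

/-! ### Integral manifolds of `ker a` by induction on dimension. -/

section Integral

/-- There is an `n`-dimensional immersed integral manifold of `ker a` through `p`, inside `U`. -/
def HasIntegralImmersion {E : Type} [NormedAddCommGroup E] [NormedSpace ℝ E]
    (a : E → E →L[ℝ] ℝ) (U : Set E) (p : E) (n : ℕ) : Prop :=
  ∃ (F : Type) (_ : NormedAddCommGroup F) (_ : NormedSpace ℝ F) (_ : FiniteDimensional ℝ F)
    (O : Set F) (g : F → E), Module.finrank ℝ F = n ∧ IsOpen O ∧ 0 ∈ O ∧ ContDiffOn ℝ ∞ g O ∧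
      g 0 = p ∧ MapsTo g O U ∧ Function.Injective (fderiv ℝ g 0) ∧
      ∀ x ∈ O, ∀ v, a (g x) (fderiv ℝ g x v) = 0

variable {E : Type} [NormedAddCommGroup E] [NormedSpace ℝ E]

theorem hasIntegralImmersion_zero {a : E → E →L[ℝ] ℝ} {U : Set E} {p : E} (hp : p ∈ U) :
    HasIntegralImmersion a U p 0 :=
  ⟨Fin 0 → ℝ, inferInstance, inferInstance, inferInstance, univ, fun _ => p, by simp, isOpen_univ,
    mem_univ _, contDiffOn_const, rfl, fun _ _ => hp, Function.injective_of_subsingleton _,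
    by simp⟩

theorem HasIntegralImmersion.of_restrictForm {a : E → E →L[ℝ] ℝ} {U : Set E} {p : E} {n : ℕ}
    {H : Submodule ℝ E} {U' : Set H} (hU' : ∀ h ∈ U', p + (h : E) ∈ U)
    (h : HasIntegralImmersion (restrictForm a p H) U' 0 n) : HasIntegralImmersion a U p n := by
  obtain ⟨F, i1, i2, i3, O, g, hF, hO, h0, hg, hg0, hgU, hinj, hga⟩ := h
  have hd : ∀ x ∈ O, fderiv ℝ (fun x => p + (g x : E)) x = H.subtypeL.comp (fderiv ℝ g x) := by
    intro x hx
    have h1 := ((hg.contDiffAt (hO.mem_nhds hx)).differentiableAt (by simp)).hasFDerivAt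
    exact ((H.subtypeL.hasFDerivAt.comp x h1).const_add p).fderiv
  refine ⟨F, i1, i2, i3, O, fun x => p + (g x : E), hF, hO, h0,
    contDiffOn_const.add (H.subtypeL.contDiff.comp_contDiffOn hg), by simp [hg0],
    fun x hx => hU' _ (hgU hx), ?_, ?_⟩
  · rw [hd 0 h0]
    exact Subtype.val_injective.comp hinj
  · intro x hx v
    rw [hd x hx]
    exact hga x hx v

/-- Sweeping out an integral manifold in a transverse hyperplane by a characteristic flow. -/
theorem HasIntegralImmersion.flow [FiniteDimensional ℝ E] {a : E → E →L[ℝ] ℝ} {U : Set E}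
    (hU : IsOpen U) (ha : ContDiffOn ℝ ∞ a U) {p : E} (hp : p ∈ U) {n : ℕ}
    {X : E → E} (hX : ContDiffOn ℝ ∞ X U) {c : E → ℝ}
    (hc : ContinuousOn c U) (hXa : ∀ x ∈ U, a x (X x) = 0)
    (hXc : ∀ x ∈ U, ∀ w, formDeriv a x (X x) w = c x * a x w)
    {H : Submodule ℝ E} (hXH : X p ∉ H) {U' : Set H}
    (h : HasIntegralImmersion (restrictForm a p H) U' 0 n) : HasIntegralImmersion a U p (n + 1) := by
  obtain ⟨F, i1, i2, i3, O, g, hF, hO, h0, hg, hg0, -, hinj, hga⟩ := h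
  obtain ⟨δ, hδ, Φ, hΦ, hΦU, hΦ0, hΦd⟩ := exists_smooth_flow hU hX hp
  have hD : IsOpen (Metric.ball (0 : ℝ) δ ×ˢ Metric.ball p δ) :=
    Metric.isOpen_ball.prod Metric.isOpen_ball
  let γ : ℝ × F → ℝ × E := fun z => (z.1, p + (g z.2 : E))
  have hγ : ContDiffOn ℝ ∞ γ (univ ×ˢ O) :=
    contDiffOn_fst.prodMk (contDiffOn_const.add
      (H.subtypeL.contDiff.comp_contDiffOn (hg.comp contDiffOn_snd fun z hz => hz.2)))
  have hUO : IsOpen ((univ : Set ℝ) ×ˢ O) := isOpen_univ.prod hO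
  let O' : Set (ℝ × F) := (univ ×ˢ O) ∩ γ ⁻¹' (Metric.ball (0 : ℝ) δ ×ˢ Metric.ball p δ)
  have hO' : IsOpen O' := hγ.continuousOn.isOpen_inter_preimage hUO hD
  have h00 : (0 : ℝ × F) ∈ O' := by
    refine ⟨⟨mem_univ _, h0⟩, ?_⟩
    simp [γ, hg0, hδ]
  have hG : ContDiffOn ℝ ∞ (Φ ∘ γ) O' :=
    hΦ.comp (hγ.mono inter_subset_left) fun z hz => hz.2
  have hfd : ∀ z ∈ O', ∀ v, fderiv ℝ (Φ ∘ γ) z v =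
      v.1 • X (Φ (γ z)) + fderiv ℝ Φ (γ z) (0, (fderiv ℝ g z.2 v.2 : E)) := by
    intro z hz v
    have h1 : HasFDerivAt g (fderiv ℝ g z.2) z.2 :=
      ((hg.contDiffAt (hO.mem_nhds hz.1.2)).differentiableAt (by simp)).hasFDerivAt
    have h2 : HasFDerivAt γ ((ContinuousLinearMap.fst ℝ ℝ F).prod
        (H.subtypeL.comp ((fderiv ℝ g z.2).comp (.snd ℝ ℝ F)))) z :=
      hasFDerivAt_fst.prodMk
        ((H.subtypeL.hasFDerivAt.comp z (h1.comp z hasFDerivAt_snd)).const_add p)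
    have h3 : HasFDerivAt Φ (fderiv ℝ Φ (γ z)) (γ z) :=
      ((hΦ.contDiffAt (hD.mem_nhds hz.2)).differentiableAt (by simp)).hasFDerivAt
    have h4 : HasDerivAt (fun s => ((s, (γ z).2) : ℝ × E)) (1, 0) (γ z).1 :=
      (hasDerivAt_id _).prodMk (hasDerivAt_const _ _)
    have h5 : fderiv ℝ Φ (γ z) (1, 0) = X (Φ (γ z)) :=
      (HasFDerivAt.comp_hasDerivAt (γ z).1 h3 h4).unique (hΦd _ hz.2.1 _ hz.2.2)
    rw [(h3.comp z h2).fderiv, ← h5, ← map_smul, ← map_add]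
    simp
  have hΦp : ∀ w, fderiv ℝ Φ (0, p) (0, w) = w := by
    intro w
    have hpδ : p ∈ Metric.ball p δ := Metric.mem_ball_self hδ
    have h1 : HasFDerivAt Φ (fderiv ℝ Φ (0, p)) (0, p) :=
      ((hΦ.contDiffAt (hD.mem_nhds ⟨Metric.mem_ball_self hδ, hpδ⟩)).differentiableAt
        (by simp)).hasFDerivAt
    have h2 := h1.comp p (hasFDerivAt_prodMk_right (𝕜 := ℝ) (0 : ℝ) p)
    have h3 : HasFDerivAt (fun y => Φ (0, y)) (.id ℝ E) p :=
      (hasFDerivAt_id p).congr_of_eventuallyEq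
        (eventually_of_mem (Metric.isOpen_ball.mem_nhds hpδ) hΦ0)
    simpa using DFunLike.congr_fun (h2.unique h3) w
  have hγ0 : γ 0 = (0, p) := by simp [γ, hg0]
  refine ⟨ℝ × F, inferInstance, inferInstance, inferInstance, O', Φ ∘ γ, ?_, hO', h00, hG, ?_,
    fun z hz => hΦU hz.2, ?_, ?_⟩
  · rw [Module.finrank_prod, Module.finrank_self, hF, add_comm]
  · rw [Function.comp_apply, hγ0]
    exact hΦ0 p (Metric.mem_ball_self hδ)
  · rw [injective_iff_map_eq_zero]
    intro v hv
    -- At the origin the derivative is `(s, u) ↦ s X(p) + dg(u)`, with `dg(u)` in `H` and `X(p)`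
    -- outside it.
    rw [hfd 0 h00, hγ0, hΦ0 p (Metric.mem_ball_self hδ), hΦp] at hv
    have h1 : v.1 = 0 := by
      by_contra hne
      refine hXH ?_
      have h2 : v.1 • X p ∈ H := by
        rw [eq_neg_of_add_eq_zero_left hv]
        exact H.neg_mem (Subtype.mem _)
      simpa [hne] using H.smul_mem v.1⁻¹ h2
    rw [h1, zero_smul, zero_add] at hv
    have h3 : fderiv ℝ g 0 v.2 = 0 := Subtype.ext hv
    exact Prod.ext h1 ((injective_iff_map_eq_zero _).1 hinj _ h3)
  · intro z hz v
    rw [hfd z hz, map_add, map_smul, Function.comp_apply, hXa _ (hΦU hz.2), smul_zero, zero_add]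
    exact flow_preserves_ker hU ha hX hc hXa hXc hΦ hΦU hΦ0 hΦd hz.2.1 hz.2.2 (hga z.2 hz.1.2 _)

/-- Since `v₀` spans a complement of `ker ℓ` and `a v₀ = 0`, a form vanishing on `ker ℓ` as well
would be zero. This keeps `a` nonzero on the slices. -/
theorem restrictForm_ne_zero {a : E →L[ℝ] ℝ} (ha : a ≠ 0) {ℓ : E →L[ℝ] ℝ} {v₀ : E}
    (hav : a v₀ = 0) (hℓ : ℓ v₀ ≠ 0) :
    a.comp (LinearMap.ker (ℓ : E →ₗ[ℝ] ℝ)).subtypeL ≠ 0 := by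
  intro h
  refine ha (ContinuousLinearMap.ext fun u => ?_)
  have hu : u - (ℓ u / ℓ v₀) • v₀ ∈ LinearMap.ker (ℓ : E →ₗ[ℝ] ℝ) := by simp [hℓ]
  have := DFunLike.congr_fun h ⟨_, hu⟩
  simpa [hav] using this

theorem finrank_ker_add_one [FiniteDimensional ℝ E] {ℓ : E →L[ℝ] ℝ} {v₀ : E} (hℓ : ℓ v₀ ≠ 0) :
    Module.finrank ℝ (LinearMap.ker (ℓ : E →ₗ[ℝ] ℝ)) + 1 = Module.finrank ℝ E := by
  have h := LinearMap.finrank_range_add_finrank_ker (ℓ : E →ₗ[ℝ] ℝ)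
  rw [LinearMap.range_eq_top.2 (LinearMap.surjective fun h0 => hℓ (LinearMap.congr_fun h0 v₀)),
    finrank_top, Module.finrank_self] at h
  omega

theorem prodMap_subtype_injective (H : Submodule ℝ E) :
    Function.Injective (H.subtype.prodMap (LinearMap.id (R := ℝ) (M := ℝ))) :=
  Function.Injective.prodMap H.injective_subtype Function.injective_id

theorem mem_range_prodMap_subtype_ker (ℓ : E →L[ℝ] ℝ) (v : E × ℝ) :
    (ℓ : E →ₗ[ℝ] ℝ).comp (LinearMap.fst ℝ E ℝ) v = 0 ↔ v ∈ LinearMap.range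
      ((LinearMap.ker (ℓ : E →ₗ[ℝ] ℝ)).subtype.prodMap (LinearMap.id (R := ℝ) (M := ℝ))) := by
  constructor
  · intro h
    exact ⟨(⟨v.1, h⟩, v.2), rfl⟩
  · rintro ⟨w, rfl⟩
    exact w.1.2

/-- If the symplectization of `a` has constant corank `k` on a `d`-dimensional space, then `ker a`
has an integral manifold of dimension `n = (d + k - 1) / 2` through every point. -/
theorem exists_integralImmersion (d : ℕ) : ∀ {E : Type} [NormedAddCommGroup E] [NormedSpace ℝ E]
    [FiniteDimensional ℝ E], Module.finrank ℝ E = d → ∀ {n k : ℕ}, 2 * n + 1 = d + k →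
    ∀ {a : E → E →L[ℝ] ℝ} {U : Set E} {p : E}, IsOpen U → p ∈ U → ContDiffOn ℝ ∞ a U →
    (∀ x ∈ U, a x ≠ 0) → (∀ x ∈ U, Module.finrank ℝ (symplRadical a x) = k) →
    HasIntegralImmersion a U p n := by
  induction d with
  | zero =>
    intro E _ _ _ hd n k _ a U p _ hp _ ha0
    have := Module.finrank_zero_iff.1 hd
    exact absurd (Subsingleton.elim _ _) (ha0 p hp)
  | succ d ih =>
    intro E _ _ _ hd n k hnk a U p hU hp ha ha0 hrad
    rcases n with _ | n
    · exact hasIntegralImmersion_zero hp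
    have hadiff : ∀ x ∈ U, DifferentiableAt ℝ a x := fun x hx =>
      (ha.contDiffAt (hU.mem_nhds hx)).differentiableAt (by simp)
    rcases k with _ | k
    -- Here `dim E = 2n + 3`, so `ker (a p)` is nontrivial.
    · obtain ⟨v₀, hv₀, hav₀⟩ : ∃ v₀, v₀ ≠ 0 ∧ a p v₀ = 0 := by
        have h := LinearMap.finrank_range_add_finrank_ker (a p : E →ₗ[ℝ] ℝ)
        have h1 := Submodule.finrank_le (LinearMap.range (a p : E →ₗ[ℝ] ℝ))
        rw [Module.finrank_self] at h1
        have : Nontrivial (LinearMap.ker (a p : E →ₗ[ℝ] ℝ)) :=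
          (Module.finrank_pos_iff (R := ℝ)).1 (by omega)
        obtain ⟨v, hv⟩ := exists_ne (0 : LinearMap.ker (a p : E →ₗ[ℝ] ℝ))
        exact ⟨v, fun h => hv (Subtype.ext h), v.2⟩
      obtain ⟨ℓ, hℓ⟩ := SeparatingDual.exists_ne_zero (R := ℝ) hv₀
      let H := LinearMap.ker (ℓ : E →ₗ[ℝ] ℝ)
      have hbs := contDiffOn_restrictForm ha p H
      have hUo : IsOpen {h : H | p + (h : E) ∈ U} := hU.preimage (by fun_prop)
      let U' : Set H := {h : H | p + (h : E) ∈ U} ∩ restrictForm a p H ⁻¹' {0}ᶜ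
      refine HasIntegralImmersion.of_restrictForm (H := H) (U' := U') (fun h hh => hh.1) ?_
      have hfr : Module.finrank ℝ H + 1 = Module.finrank ℝ E := finrank_ker_add_one hℓ
      refine ih (n := n + 1) (k := 1) (by omega) (by omega)
        (hbs.continuousOn.isOpen_inter_preimage hUo isOpen_compl_singleton) ⟨?_, ?_⟩
        (hbs.mono inter_subset_left) (fun x hx => hx.2) fun x hx => ?_
      · simpa using hp
      · simpa [restrictForm] using restrictForm_ne_zero (ha0 p hp) hav₀ hℓ
      · have h1 := finrank_ker_compl₁₂_hyperplane_of_injective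
          (symplectization a (p + x)).toLinearMap₁₂ (symplectization_self a _)
          (by
            rw [← LinearMap.ker_eq_bot, ← symplRadical_eq_ker, ← Submodule.finrank_eq_zero]
            exact hrad _ hx.1)
          _ (prodMap_subtype_injective H) ((ℓ : E →ₗ[ℝ] ℝ).comp (LinearMap.fst ℝ E ℝ))
          (fun h0 => hℓ (LinearMap.congr_fun h0 (v₀, 0)))
          (mem_range_prodMap_subtype_ker ℓ)
        rw [← symplectization_restrictForm (hadiff _ hx.1), ← symplRadical_eq_ker,
          Module.finrank_prod, Module.finrank_prod] at h1
        rw [Module.finrank_self] at h1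
        change _ + (Module.finrank ℝ H + _) = _ at h1
        omega
    · obtain ⟨z₀, hz₀⟩ : ∃ z₀ : symplRadical a p, z₀ ≠ 0 := by
        have : Nontrivial (symplRadical a p) :=
          (Module.finrank_pos_iff (R := ℝ)).1 (by rw [hrad p hp]; omega)
        exact exists_ne _
      have hz₀' := (symplectization_eq_zero_iff a p z₀).1 z₀.2
      -- A radical vector `(0, s)` satisfies `s a = 0`, hence `s = 0`.
      have hv₀ : (z₀ : E × ℝ).1 ≠ 0 := by
        intro h
        apply hz₀
        obtain ⟨u, hu⟩ : ∃ u, a p u ≠ 0 := by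
          by_contra! hc
          exact ha0 p hp (ContinuousLinearMap.ext hc)
        have h2 := hz₀'.2 u
        rw [h] at h2
        have h3 : (z₀ : E × ℝ).2 = 0 := by
          simpa [formDeriv, hu] using h2
        exact Subtype.ext (Prod.ext h h3)
      obtain ⟨ℓ, hℓ⟩ := SeparatingDual.exists_ne_zero (R := ℝ) hv₀
      obtain ⟨U₁, hU₁U, hU₁, hpU₁, Z, hZ, hZp, hZk⟩ := exists_smooth_section_ker hU
        (contDiffOn_symplectization hU ha) hrad hp z₀.2
      have hℓZ : ContinuousOn (fun x => ℓ (Z x).1) U₁ :=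
        ℓ.continuous.comp_continuousOn (continuous_fst.comp_continuousOn hZ.continuousOn)
      -- On `U₂` the characteristic field stays transverse to the translates of `ker ℓ`, so the
      -- corank drops by exactly one at every point of the slice.
      let U₂ : Set E := U₁ ∩ (fun x => ℓ (Z x).1) ⁻¹' {0}ᶜ
      have hU₂ : IsOpen U₂ := hℓZ.isOpen_inter_preimage hU₁ isOpen_compl_singleton
      have hpU₂ : p ∈ U₂ := ⟨hpU₁, by simpa [hZp] using hℓ⟩
      have hU₂U : U₂ ⊆ U := fun x hx => hU₁U hx.1
      have haU₂ := ha.mono hU₂U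
      let H := LinearMap.ker (ℓ : E →ₗ[ℝ] ℝ)
      have hbs := contDiffOn_restrictForm haU₂ p H
      have hUo : IsOpen {h : H | p + (h : E) ∈ U₂} := hU₂.preimage (by fun_prop)
      let U' : Set H := {h : H | p + (h : E) ∈ U₂} ∩ restrictForm a p H ⁻¹' {0}ᶜ
      have hfr : Module.finrank ℝ H + 1 = Module.finrank ℝ E := finrank_ker_add_one hℓ
      have hH : HasIntegralImmersion (restrictForm a p H) U' 0 n := by
        refine ih (k := k) (by omega) (by omega)
          (hbs.continuousOn.isOpen_inter_preimage hUo isOpen_compl_singleton) ⟨?_, ?_⟩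
          (hbs.mono inter_subset_left) (fun x hx => hx.2) fun x hx => ?_
        · simpa using hpU₂
        · simpa [restrictForm] using restrictForm_ne_zero (ha0 p hp) hz₀'.1 hℓ
        · have h1 := finrank_ker_compl₁₂_hyperplane_of_mem_ker
            (symplectization a (p + x)).toLinearMap₁₂ (symplectization_self a _)
            _ (prodMap_subtype_injective H) ((ℓ : E →ₗ[ℝ] ℝ).comp (LinearMap.fst ℝ E ℝ))
            (mem_range_prodMap_subtype_ker ℓ) (X := Z (p + x))
            (by
              rw [← LinearMap.mem_ker, ← symplRadical_eq_ker]
              exact hZk _ hx.1.1) hx.1.2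
          rw [← symplectization_restrictForm (hadiff _ (hU₂U hx.1)), ← symplRadical_eq_ker,
            ← symplRadical_eq_ker, hrad _ (hU₂U hx.1)] at h1
          omega
      have hfin : HasIntegralImmersion a U₂ p (n + 1) := by
        refine HasIntegralImmersion.flow hU₂ haU₂ hpU₂ (X := fun x => (Z x).1)
          (c := fun x => -(Z x).2) (contDiff_fst.comp_contDiffOn (hZ.mono inter_subset_left))
          ((continuous_snd.comp_continuousOn (hZ.mono inter_subset_left).continuousOn).neg)
          (fun x hx => ((symplectization_eq_zero_iff a x _).1 (hZk x hx.1)).1)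
          (fun x hx w => ?_) (H := H) ?_ hH
        · rw [((symplectization_eq_zero_iff a x _).1 (hZk x hx.1)).2 w, neg_mul]
        · rw [hZp]
          exact hℓ
      obtain ⟨F, i1, i2, i3, O, g, hF, hO, h0, hg, hg0, hgU, hr⟩ := hfin
      exact ⟨F, i1, i2, i3, O, g, hF, hO, h0, hg, hg0, fun x hx => hU₂U (hgU hx), hr⟩

end Integral

/-! ### Forms, tangent vectors and immersions in charts. -/

section Charts

variable {m : ℕ} {Y : Type*} [TopologicalSpace Y] [ChartedSpace (Model m) Y]

theorem mdifferentiable_of_mem_maximalAtlas {φ : OpenPartialHomeomorph Y (Model m)}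
    (hφ : φ ∈ IsManifold.maximalAtlas (𝓡 m) ∞ Y) : φ.MDifferentiable (𝓡 m) (𝓡 m) :=
  ⟨(contMDiffOn_of_mem_maximalAtlas hφ).mdifferentiableOn (by simp),
    (contMDiffOn_symm_of_mem_maximalAtlas hφ).mdifferentiableOn (by simp)⟩

/-- The differential of a chart, with values in the model space. -/
def chartDiff (φ : OpenPartialHomeomorph Y (Model m)) (q : Y) (v : TangentSpace (𝓡 m) q) :
    Model m :=
  mfderiv (𝓡 m) (𝓡 m) φ q v

theorem chartDiff_zero (φ : OpenPartialHomeomorph Y (Model m)) (q : Y) :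
    chartDiff φ q 0 = 0 :=
  map_zero (mfderiv (𝓡 m) (𝓡 m) φ q)

theorem chartDiff_surjective {φ : OpenPartialHomeomorph Y (Model m)}
    (hφ : φ ∈ IsManifold.maximalAtlas (𝓡 m) ∞ Y) {q : Y} (hq : q ∈ φ.source) :
    Function.Surjective (chartDiff φ q) :=
  (mdifferentiable_of_mem_maximalAtlas hφ).mfderiv_surjective hq

/-- All tangent spaces are the model space by definition, so `φ.symm (φ q)` can be replaced by `q`
without a cast. -/
theorem OneForm.apply_congr (α : OneForm m Y) {q q' : Y} (h : q = q') (u : Model m) :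
    α q u = α q' u := by
  subst h
  rfl

theorem OneForm.inChart_chartDiff (α : OneForm m Y) {φ : OpenPartialHomeomorph Y (Model m)}
    (hφ : φ ∈ IsManifold.maximalAtlas (𝓡 m) ∞ Y) {q : Y} (hq : q ∈ φ.source)
    (v : TangentSpace (𝓡 m) q) :
    α.inChart φ (φ q) (chartDiff φ q v) = α q v := by
  have h := DFunLike.congr_fun ((mdifferentiable_of_mem_maximalAtlas hφ).symm_comp_deriv hq) v
  exact (α.apply_congr (φ.left_inv hq) _).trans (congrArg (α q) h)

theorem contDiffAt_transition {φ χ : OpenPartialHomeomorph Y (Model m)}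
    (hφ : φ ∈ IsManifold.maximalAtlas (𝓡 m) ∞ Y) (hχ : χ ∈ IsManifold.maximalAtlas (𝓡 m) ∞ Y)
    {y : Model m} (hy : y ∈ χ.target) (hyφ : χ.symm y ∈ φ.source) :
    ContDiffAt ℝ ∞ (φ ∘ χ.symm) y :=
  contMDiffAt_iff_contDiffAt.1 ((contMDiffAt_of_mem_maximalAtlas hφ hyφ).comp y
    (contMDiffAt_symm_of_mem_maximalAtlas hχ hy))

theorem OneForm.inChart_eq_pullback (α : OneForm m Y) {φ χ : OpenPartialHomeomorph Y (Model m)}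
    (hφ : φ ∈ IsManifold.maximalAtlas (𝓡 m) ∞ Y) (hχ : χ ∈ IsManifold.maximalAtlas (𝓡 m) ∞ Y)
    {y : Model m} (hy : y ∈ χ.target) (hyφ : χ.symm y ∈ φ.source) :
    α.inChart χ y = (α.inChart φ ((φ ∘ χ.symm) y)).comp (fderiv ℝ (φ ∘ χ.symm) y) := by
  ext u
  have h1 : mfderiv (𝓡 m) (𝓡 m) (φ ∘ χ.symm) y u = mfderiv (𝓡 m) (𝓡 m) φ (χ.symm y)
      (mfderiv (𝓡 m) (𝓡 m) χ.symm y u) :=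
    mfderiv_comp_apply _ ((mdifferentiable_of_mem_maximalAtlas hφ).mdifferentiableAt hyφ)
      ((mdifferentiable_of_mem_maximalAtlas hχ).mdifferentiableAt_symm hy) u
  rw [mfderiv_eq_fderiv] at h1
  exact ((congrArg (α.inChart φ (φ (χ.symm y))) h1).trans (α.inChart_chartDiff hφ hyφ _)).symm

theorem fderiv_transition {φ χ : OpenPartialHomeomorph Y (Model m)}
    (hφ : φ ∈ IsManifold.maximalAtlas (𝓡 m) ∞ Y) (hχ : χ ∈ IsManifold.maximalAtlas (𝓡 m) ∞ Y)
    {q : Y} (hqφ : q ∈ φ.source) (hqχ : q ∈ χ.source) (v : TangentSpace (𝓡 m) q) :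
    fderiv ℝ (φ ∘ χ.symm) (χ q) (chartDiff χ q v) = chartDiff φ q v := by
  have hτ := contDiffAt_transition hφ hχ (χ.map_source hqχ) (by rwa [χ.left_inv hqχ])
  have h1 : (φ ∘ χ.symm) ∘ χ =ᶠ[𝓝 q] φ := by
    filter_upwards [χ.open_source.mem_nhds hqχ] with z hz
    simp [χ.left_inv hz]
  have h2 : mfderiv (𝓡 m) (𝓡 m) ((φ ∘ χ.symm) ∘ χ) q v =
      mfderiv (𝓡 m) (𝓡 m) (φ ∘ χ.symm) (χ q) (mfderiv (𝓡 m) (𝓡 m) χ q v) :=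
    mfderiv_comp_apply q (hτ.differentiableAt (by simp)).mdifferentiableAt
      ((mdifferentiable_of_mem_maximalAtlas hχ).mdifferentiableAt hqχ) v
  rw [mfderiv_eq_fderiv] at h2
  exact h2.symm.trans (DFunLike.congr_fun h1.mfderiv_eq v)

variable [IsManifold (𝓡 m) ∞ Y]

/-- The exterior derivative may be computed in any chart. -/
theorem OneForm.extDerivAt_eq_formDeriv (α : OneForm m Y) {U : Set Y} (hU : IsOpen U)
    (hα : α.SmoothOn U) {φ : OpenPartialHomeomorph Y (Model m)}
    (hφ : φ ∈ IsManifold.maximalAtlas (𝓡 m) ∞ Y) {q : Y} (hq : q ∈ φ.source) (hqU : q ∈ U)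
    (v w : TangentSpace (𝓡 m) q) :
    α.extDerivAt q v w = formDeriv (α.inChart φ) (φ q) (chartDiff φ q v) (chartDiff φ q w) := by
  let χ := chartAt (Model m) q
  have hχ : χ ∈ IsManifold.maximalAtlas (𝓡 m) ∞ Y := IsManifold.chart_mem_maximalAtlas q
  have hqχ : q ∈ χ.source := mem_chart_source _ q
  have hq' : χ.symm (χ q) = q := χ.left_inv hqχ
  have hτq : (φ ∘ χ.symm) (χ q) = φ q := congrArg φ hq'
  have hev : α.inChart χ =ᶠ[𝓝 (χ q)]
      fun y => (α.inChart φ ((φ ∘ χ.symm) y)).comp (fderiv ℝ (φ ∘ χ.symm) y) := by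
    filter_upwards [(χ.isOpen_inter_preimage_symm φ.open_source).mem_nhds
      ⟨χ.map_source hqχ, by simpa [hq'] using hq⟩] with y hy
    exact α.inChart_eq_pullback hφ hχ hy.1 hy.2
  have hd : DifferentiableAt ℝ (α.inChart φ) ((φ ∘ χ.symm) (χ q)) := by
    rw [hτq]
    exact ((hα φ hφ).contDiffAt ((φ.isOpen_inter_preimage_symm hU).mem_nhds
      ⟨φ.map_source hq, by simpa [φ.left_inv hq] using hqU⟩)).differentiableAt (by simp)
  change formDeriv (α.inChart χ) (χ q) (chartDiff χ q v) (chartDiff χ q w) = _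
  rw [formDeriv_congr hev, formDeriv_pullback
    ((contDiffAt_transition hφ hχ (χ.map_source hqχ) (by rwa [hq'])).of_le ENat.LEInfty.out) hd,
    fderiv_transition hφ hχ hq hqχ, fderiv_transition hφ hχ hq hqχ, hτq]

omit [IsManifold (𝓡 m) ∞ Y] in
theorem chartDiff_mem_of_mem_tangentSet {φ : OpenPartialHomeomorph Y (Model m)}
    (hφ : φ ∈ IsManifold.maximalAtlas (𝓡 m) ∞ Y) {C : Set Y} {V : Submodule ℝ (Model m)}
    (hV : ∀ q ∈ φ.source, q ∈ C → φ q ∈ V) {q : Y} (hq : q ∈ φ.source)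
    {v : TangentSpace (𝓡 m) q} (hv : v ∈ tangentSet m C q) :
    chartDiff φ q v ∈ V := by
  obtain ⟨γ, rfl, hγC, hγ, rfl⟩ := hv
  have hγd := hγ.mdifferentiableAt (by simp)
  have hφd := (mdifferentiable_of_mem_maximalAtlas hφ).mdifferentiableAt hq
  have h1 : mfderiv 𝓘(ℝ, ℝ) (𝓡 m) (φ ∘ γ) 0 (1 : ℝ) =
      mfderiv (𝓡 m) (𝓡 m) φ (γ 0) (mfderiv 𝓘(ℝ, ℝ) (𝓡 m) γ 0 (1 : ℝ)) :=
    mfderiv_comp_apply _ hφd hγd _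
  rw [mfderiv_eq_fderiv] at h1
  have h2 : HasFDerivAt (φ ∘ γ) (fderiv ℝ (φ ∘ γ) 0) 0 :=
    (hφd.comp 0 hγd).differentiableAt.hasFDerivAt
  -- The projection to `V` fixes the curve near time `0`, hence also its velocity.
  have h3 : V.starProjection ∘ (φ ∘ γ) =ᶠ[𝓝 0] φ ∘ γ := by
    filter_upwards [hγC, hγ.continuousAt.preimage_mem_nhds (φ.open_source.mem_nhds hq)] with t ht ht'
    exact Submodule.starProjection_eq_self_iff.2 (hV _ ht' ht)
  have h4 := (V.starProjection.hasFDerivAt.comp 0 h2).unique (h2.congr_of_eventuallyEq h3)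
  have h5 := DFunLike.congr_fun h4 (1 : ℝ)
  have h6 : fderiv ℝ (φ ∘ γ) 0 (1 : ℝ) ∈ V := Submodule.starProjection_eq_self_iff.1 h5
  have h7 : fderiv ℝ (φ ∘ γ) 0 (1 : ℝ) = chartDiff φ (γ 0) (mfderiv 𝓘(ℝ, ℝ) (𝓡 m) γ 0 (1 : ℝ)) := h1
  exact h7 ▸ h6

/-- The germ of an immersion into a chart is an embedded submanifold. -/
theorem exists_submanifold_of_immersion {φ : OpenPartialHomeomorph Y (Model m)}
    (hφ : φ ∈ IsManifold.maximalAtlas (𝓡 m) ∞ Y) {p : Y} (hp : p ∈ φ.source)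
    {F : Type} [NormedAddCommGroup F] [NormedSpace ℝ F] [FiniteDimensional ℝ F]
    {O : Set F} (hO : IsOpen O) (h0 : 0 ∈ O) {g : F → Model m} (hg : ContDiffOn ℝ ∞ g O)
    (hg0 : g 0 = φ p) (hinj : Function.Injective (fderiv ℝ g 0)) :
    ∃ Λ : Set Y, IsSubmanifold m (Module.finrank ℝ F) Λ ∧ p ∈ Λ ∧
      ∀ q ∈ Λ, q ∈ φ.source ∧ ∃ x ∈ O, φ q = g x ∧ ∀ v ∈ tangentSet m Λ q, ∃ u,
        chartDiff φ q v = fderiv ℝ g x u := by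
  have hgd : ∀ x ∈ O, HasFDerivAt g (fderiv ℝ g x) x := fun x hx =>
    ((hg.contDiffAt (hO.mem_nhds hx)).differentiableAt (by simp)).hasFDerivAt
  let R : Submodule ℝ (Model m) := LinearMap.range (fderiv ℝ g 0 : F →ₗ[ℝ] Model m)
  obtain ⟨K, hK⟩ := R.exists_isCompl
  let A : F × K →ₗ[ℝ] Model m :=
    (fderiv ℝ g 0 : F →ₗ[ℝ] Model m).coprod K.subtype
  have hAinj : Function.Injective A := by
    rw [injective_iff_map_eq_zero]
    rintro ⟨u, k⟩ h
    have h1 : fderiv ℝ g 0 u + (k : Model m) = 0 := h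
    have h2 : fderiv ℝ g 0 u = 0 := by
      refine Submodule.disjoint_def.1 hK.disjoint _ ⟨u, rfl⟩ ?_
      rw [eq_neg_of_add_eq_zero_left h1]
      exact K.neg_mem k.2
    rw [h2, zero_add] at h1
    exact Prod.ext ((injective_iff_map_eq_zero _).1 hinj _ h2) (Subtype.ext h1)
  have hAsurj : Function.Surjective A := by
    intro z
    obtain ⟨_, ⟨u, rfl⟩, k, hk, rfl⟩ := Submodule.mem_sup.1
      (hK.sup_eq_top ▸ Submodule.mem_top : z ∈ R ⊔ K)
    exact ⟨(u, ⟨k, hk⟩), rfl⟩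
  let e : (F × K) ≃L[ℝ] Model m :=
    (LinearEquiv.ofBijective A ⟨hAinj, hAsurj⟩).toContinuousLinearEquiv
  have he : ∀ z, e z = fderiv ℝ g 0 z.1 + (z.2 : Model m) := fun z => rfl
  have heR : ∀ z, e z ∈ R ↔ z.2 = 0 := by
    intro z
    rw [he]
    constructor
    · intro h
      have h1 : (z.2 : Model m) ∈ R := by
        have := R.sub_mem h ⟨z.1, rfl⟩
        simpa using this
      exact Subtype.ext (Submodule.disjoint_def.1 hK.disjoint _ h1 z.2.2)
    · intro h
      rw [h]
      exact ⟨z.1, by simp⟩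
  -- A complement `K` of the tangent space at the origin thickens `g` to a local diffeomorphism with
  -- derivative `e` there. In the chart `ψ = e ∘ θ⁻¹ ∘ φ` the slice with zero `K`-component is cut
  -- out by `R`.
  let Θ : F × K → Model m := fun z => g z.1 + (z.2 : Model m)
  have hΘ : ContDiffOn ℝ ∞ Θ (O ×ˢ univ) :=
    (hg.comp contDiffOn_fst fun z hz => hz.1).add
      (K.subtypeL.contDiff.comp_contDiffOn contDiffOn_snd)
  have hΘd : ∀ z : F × K, z.1 ∈ O → HasFDerivAt Θ
      ((fderiv ℝ g z.1).comp (.fst ℝ F K) + K.subtypeL.comp (.snd ℝ F K)) z := fun z hz =>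
    ((hgd _ hz).comp z hasFDerivAt_fst).add (K.subtypeL.hasFDerivAt.comp z hasFDerivAt_snd)
  obtain ⟨θ, hθ, h0θ, hθO, hθs, hθs'⟩ := exists_openPartialHomeomorph_contDiffOn
    (hO.prod isOpen_univ) hΘ (a := 0) ⟨h0, mem_univ _⟩ e ((hΘd 0 h0).congr_fderiv (by
      ext z
      · simp [he]
      · simp [he]))
  let ε : OpenPartialHomeomorph (F × K) (Model m) := e.toHomeomorph.toOpenPartialHomeomorph
  let ψ : OpenPartialHomeomorph Y (Model m) := (φ.trans θ.symm).trans ε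
  have hψsource : ∀ q, q ∈ ψ.source ↔ q ∈ φ.source ∧ φ q ∈ θ.target := by
    intro q
    simp [ψ, ε]
  have hψtarget : ∀ y, y ∈ ψ.target ↔ e.symm y ∈ θ.source ∧ θ (e.symm y) ∈ φ.target := by
    intro y
    simp [ψ, ε]
  have hψ : ψ ∈ IsManifold.maximalAtlas (𝓡 m) ∞ Y := by
    apply OpenPartialHomeomorph.mem_maximalAtlas_of_contMDiffOn
    · have h1 : ContDiffOn ℝ ∞ (fun y => e (θ.symm y)) θ.target := e.contDiff.comp_contDiffOn hθs'
      exact h1.contMDiffOn.comp ((contMDiffOn_of_mem_maximalAtlas hφ).mono fun q hq =>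
        ((hψsource q).1 hq).1) fun q hq => ((hψsource q).1 hq).2
    · have h1 : ContDiffOn ℝ ∞ (fun y => θ (e.symm y)) ψ.target :=
        hθs.comp e.symm.contDiff.contDiffOn fun y hy => ((hψtarget y).1 hy).1
      exact (contMDiffOn_symm_of_mem_maximalAtlas hφ).comp h1.contMDiffOn
        fun y hy => ((hψtarget y).1 hy).2
  have hΘ0 : θ 0 = φ p := by
    rw [hθ]
    simp [Θ, hg0]
  refine ⟨{q | q ∈ ψ.source ∧ ψ q ∈ R}, ?_, ?_, ?_⟩
  · rintro q ⟨hq, -⟩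
    refine ⟨ψ, hψ, hq, R, LinearMap.finrank_range_of_inj hinj, fun q' hq' => ?_⟩
    exact ⟨fun h => h.2, fun h => ⟨hq', h⟩⟩
  · refine ⟨(hψsource p).2 ⟨hp, hΘ0 ▸ θ.map_source h0θ⟩, ?_⟩
    change e (θ.symm (φ p)) ∈ R
    rw [← hΘ0, θ.left_inv h0θ, heR]
    rfl
  · rintro q ⟨hq, hqR⟩
    obtain ⟨hqφ, hqθ⟩ := (hψsource q).1 hq
    have hz2 : (θ.symm (φ q)).2 = 0 := (heR _).1 hqR
    have hzs := θ.map_target hqθ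
    have hφq := θ.right_inv hqθ
    have heq : e.symm (ψ q) = θ.symm (φ q) := e.symm_apply_apply _
    set z := θ.symm (φ q)
    have hzO : z.1 ∈ O := (hθO hzs).1
    refine ⟨hqφ, z.1, hzO, ?_, fun v hv => ?_⟩
    · rw [← hφq, hθ]
      simp [Θ, hz2]
    · obtain ⟨u, hu⟩ := chartDiff_mem_of_mem_tangentSet hψ (C := {q | q ∈ ψ.source ∧ ψ q ∈ R}) (V := R)
        (fun q _ h => h.2) hq hv
      refine ⟨u, ?_⟩
      rw [← fderiv_transition hφ hψ hqφ hq, ← hu]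
      have h1 : HasFDerivAt (fun y => Θ (e.symm y)) (((fderiv ℝ g z.1).comp (.fst ℝ F K) +
          K.subtypeL.comp (.snd ℝ F K)).comp (e.symm : Model m →L[ℝ] F × K)) (ψ q) := by
        have h2 := hΘd (e.symm (ψ q)) (by rwa [heq])
        have h3 := h2.comp (ψ q) e.symm.hasFDerivAt
        rwa [heq] at h3
      have h4 : φ ∘ ψ.symm =ᶠ[𝓝 (ψ q)] fun y => Θ (e.symm y) := by
        filter_upwards [ψ.open_target.mem_nhds (ψ.map_source hq)] with y hy
        rw [← hθ]
        exact φ.right_inv ((hψtarget y).1 hy).2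
      rw [(h1.congr_of_eventuallyEq h4).fderiv]
      have h5 : e.symm (fderiv ℝ g 0 u) = (u, 0) := by
        rw [ContinuousLinearEquiv.symm_apply_eq, he]
        simp
      change fderiv ℝ g z.1 (e.symm (fderiv ℝ g 0 u)).1 + ((e.symm (fderiv ℝ g 0 u)).2 : Model m) = _
      rw [h5]
      simp

end Charts

/-! ### Contact forms and coisotropy in terms of the symplectization. -/

section Contact

variable {n : ℕ} {Y : Type*} [TopologicalSpace Y] [ChartedSpace (Model (2 * n + 1)) Y]

theorem IsContactFormOn.inChart_ne_zero
    {ξ : ∀ q : Y, Submodule ℝ (TangentSpace (𝓡 (2 * n + 1)) q)} {U : Set Y}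
    {α : OneForm (2 * n + 1) Y} (hα : IsContactFormOn ξ U α)
    {φ : OpenPartialHomeomorph Y (Model (2 * n + 1))}
    (hφ : φ ∈ IsManifold.maximalAtlas (𝓡 (2 * n + 1)) ∞ Y) {q : Y} (hq : q ∈ φ.source)
    (hqU : q ∈ U) : α.inChart φ (φ q) ≠ 0 := by
  intro h
  refine hα.ne_zero q hqU (ContinuousLinearMap.ext fun v => ?_)
  rw [← α.inChart_chartDiff hφ hq, h]
  rfl

variable [IsManifold (𝓡 (2 * n + 1)) ∞ Y] in
/-- The symplectization of a contact form is nondegenerate. -/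
theorem IsContactFormOn.symplectization_injective
    {ξ : ∀ q : Y, Submodule ℝ (TangentSpace (𝓡 (2 * n + 1)) q)} {U : Set Y}
    {α : OneForm (2 * n + 1) Y} (hα : IsContactFormOn ξ U α)
    {φ : OpenPartialHomeomorph Y (Model (2 * n + 1))}
    (hφ : φ ∈ IsManifold.maximalAtlas (𝓡 (2 * n + 1)) ∞ Y) {q : Y} (hq : q ∈ φ.source)
    (hqU : q ∈ U) :
    Function.Injective (symplectization (α.inChart φ) (φ q)).toLinearMap₁₂ := by
  rw [← LinearMap.ker_eq_bot, ← symplRadical_eq_ker, eq_bot_iff]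
  rintro ⟨v, s⟩ hv
  obtain ⟨hav, hd⟩ := (symplectization_eq_zero_iff _ _ _).1 hv
  obtain ⟨v', rfl⟩ := chartDiff_surjective hφ hq v
  simp only at hav hd
  rw [α.inChart_chartDiff hφ hq] at hav
  -- The vector `v'` lies in `ξ`, and `dα(v', ·) = -s α` vanishes on `ξ`.
  have hv0 : v' = 0 := by
    refine hα.nondegenerate q hqU v' ((hα.ker_eq q hqU v').2 hav) fun w hw => ?_
    rw [α.extDerivAt_eq_formDeriv hα.isOpen hα.smoothOn hφ hq hqU, hd,
      α.inChart_chartDiff hφ hq, (hα.ker_eq q hqU w).1 hw, mul_zero, neg_zero]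
  subst hv0
  obtain ⟨u, hu⟩ : ∃ u, α.inChart φ (φ q) u ≠ 0 := by
    by_contra! hc
    exact hα.inChart_ne_zero hφ hq hqU (ContinuousLinearMap.ext hc)
  have h := hd u
  rw [chartDiff_zero] at h
  have hs : s = 0 := by
    simpa [formDeriv, hu] using h
  rw [hs, chartDiff_zero]
  exact Submodule.zero_mem _

variable [IsManifold (𝓡 (2 * n + 1)) ∞ Y]

/-- In a chart straightening a coisotropic `C` to `V`, the orthogonal complement of `V × ℝ` in the
symplectization is contained in `V × ℝ`. -/
theorem mem_of_coisotropic {ξ : ContactStructure n Y} {C : Set Y} {U : Set Y}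
    {α : OneForm (2 * n + 1) Y} (hα : IsContactFormOn ξ.plane U α)
    {φ : OpenPartialHomeomorph Y (Model (2 * n + 1))}
    (hφ : φ ∈ IsManifold.maximalAtlas (𝓡 (2 * n + 1)) ∞ Y) {V : Submodule ℝ (Model (2 * n + 1))}
    (hV : ∀ q ∈ φ.source, q ∈ C → φ q ∈ V) {q : Y} (hq : q ∈ φ.source)
    (hqU : q ∈ U) (hC : ξ.IsCoisotropicAt C q) {v : Model (2 * n + 1) × ℝ}
    (hv : ∀ w ∈ V, ∀ t : ℝ, symplectization (α.inChart φ) (φ q) v (w, t) = 0) : v.1 ∈ V := by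
  obtain ⟨v, s⟩ := v
  obtain ⟨v', rfl⟩ := chartDiff_surjective hφ hq v
  -- Pairing with `(0, 1)` puts `v'` in `ξ`; pairing with `(w, 0)` for `w` tangent to `C` and in `ξ`
  -- then gives `dα(v', w) = 0`. Both the test vectors and the conclusion use only that the chart
  -- maps tangent vectors of `C` into `V`.
  have h1 := hv 0 V.zero_mem 1
  rw [symplectization_apply] at h1
  simp [formDeriv] at h1
  rw [α.inChart_chartDiff hφ hq] at h1
  have h2 := hC U α hqU hα v' ((hα.ker_eq q hqU v').2 h1) fun w hw => by
    have h3 := hv _ (chartDiff_mem_of_mem_tangentSet hφ hV hq hw.1) 0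
    rw [symplectization_apply] at h3
    simp only [mul_zero, sub_zero] at h3
    rw [α.inChart_chartDiff hφ hq, (hα.ker_eq q hqU w).1 hw.2, mul_zero, add_zero] at h3
    rw [α.extDerivAt_eq_formDeriv hα.isOpen hα.smoothOn hφ hq hqU]
    exact h3
  exact chartDiff_mem_of_mem_tangentSet hφ hV hq h2.1

end Contact

end

end ContactGeometry

/-! ### The Legendrian through `p`. -/

open ContactGeometry in
theorem proposition4p7 (n : ℕ) {Y : Type*} [TopologicalSpace Y]
    [ChartedSpace (ContactGeometry.Model (2 * n + 1)) Y] [IsManifold (𝓡 (2 * n + 1)) ∞ Y]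
    (ξ : ContactGeometry.ContactStructure n Y) (d : ℕ) (C : Set Y)
    (hC : ξ.IsCoisotropicSubmanifold d C) (p : Y) (hp : p ∈ C)
    (hξ : ¬ ContactGeometry.tangentSet (2 * n + 1) C p ⊆ (ξ.plane p : Set (TangentSpace (𝓡 (2 * n + 1)) p))) :
    ∃ Λ : Set Y, ξ.IsLegendrianSubmanifold Λ ∧ p ∈ Λ ∧ Λ ⊆ C := by
  obtain ⟨hsub, hco⟩ := hC
  obtain ⟨φ, hφ, hpφ, V, hVd, hV⟩ := hsub p hp
  obtain ⟨U, α, hpU, hα⟩ := ξ.exists_contactForm p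
  have hV' : ∀ q ∈ φ.source, q ∈ C → φ q ∈ V := fun q hq => (hV q hq).1
  let a := α.inChart φ
  let D : Set (Model (2 * n + 1)) := φ.target ∩ φ.symm ⁻¹' U
  have hD : IsOpen D := φ.isOpen_inter_preimage_symm hα.isOpen
  have ha : ContDiffOn ℝ ∞ a D := hα.smoothOn φ hφ
  have hpD : φ p ∈ D := ⟨φ.map_source hpφ, by simpa [φ.left_inv hpφ] using hpU⟩
  have hpV : φ p ∈ V := hV' p hpφ hp
  have hUo : IsOpen {h : V | φ p + (h : Model (2 * n + 1)) ∈ D} := hD.preimage (by fun_prop)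
  have hbs := contDiffOn_restrictForm ha (φ p) V
  let U' : Set V :=
    {h : V | φ p + (h : Model (2 * n + 1)) ∈ D} ∩ restrictForm a (φ p) V ⁻¹' {0}ᶜ
  have hU' : IsOpen U' := hbs.continuousOn.isOpen_inter_preimage hUo isOpen_compl_singleton
  have h0U' : (0 : V) ∈ U' := by
    obtain ⟨v, hv, hvξ⟩ := not_subset.1 hξ
    refine ⟨by simpa using hpD, fun h => hvξ ((hα.ker_eq p hpU v).2 ?_)⟩
    have h1 := DFunLike.congr_fun h ⟨_, chartDiff_mem_of_mem_tangentSet hφ hV' hpφ hv⟩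
    have h2 : a (φ p + (0 : V)) (chartDiff φ p v) = 0 := h1
    rw [Submodule.coe_zero, add_zero] at h2
    rw [← h2]
    exact (α.inChart_chartDiff hφ hpφ v).symm
  -- The ambient symplectization has dimension `2n + 2` and its coisotropic subspace `V × ℝ` has
  -- dimension `d + 1`.
  have hrank : ∀ h ∈ U', Module.finrank ℝ (symplRadical (restrictForm a (φ p) V) h) + d =
      2 * n + 1 := by
    intro h hh
    have hx : φ p + (h : Model (2 * n + 1)) ∈ D := hh.1
    set q := φ.symm (φ p + (h : Model (2 * n + 1)))
    have hq : q ∈ φ.source := φ.map_target hx.1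
    have hφq : φ q = φ p + (h : Model (2 * n + 1)) := φ.right_inv hx.1
    have hqC : q ∈ C := (hV q hq).2 (hφq ▸ V.add_mem hpV h.2)
    have hker := finrank_ker_compl₁₂_of_orthogonal_le
      (symplectization a (φ p + (h : Model (2 * n + 1)))).toLinearMap₁₂
      (hφq ▸ hα.symplectization_injective hφ hq hx.2) _ (prodMap_subtype_injective V) (by
        intro v hv
        have hvV : v.1 ∈ V := mem_of_coisotropic hα hφ hV' hq hx.2 (hco q hqC)
          fun w hw t => by
            rw [hφq]
            exact hv (⟨w, hw⟩, t)
        exact ⟨(⟨v.1, hvV⟩, v.2), rfl⟩)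
    rw [← symplectization_restrictForm
      ((ha.contDiffAt (hD.mem_nhds hx)).differentiableAt (by simp)), ← symplRadical_eq_ker,
      Module.finrank_prod, Module.finrank_prod, Module.finrank_self, hVd,
      finrank_euclideanSpace_fin] at hker
    omega
  -- This yields `d ≤ 2n + 1`, so the natural subtraction in `k` is not truncated.
  have hr0 := hrank 0 h0U'
  have himm : HasIntegralImmersion (restrictForm a (φ p) V) U' 0 n :=
    exists_integralImmersion d hVd (k := 2 * n + 1 - d) (by omega) hU' h0U'
      (hbs.mono inter_subset_left) (fun h hh => hh.2) fun h hh => by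
        have := hrank h hh
        omega
  obtain ⟨F, i1, i2, i3, O, g, hF, hO, h0, hg, hg0, hgU, hinj, hga⟩ :=
    -- Keeping the image inside `V` is what places `Λ` in `C`.
    HasIntegralImmersion.of_restrictForm (U := D ∩ V)
      (fun h hh => ⟨hh.1, V.add_mem hpV h.2⟩) himm
  obtain ⟨Λ, hΛ, hpΛ, hΛq⟩ := exists_submanifold_of_immersion hφ hpφ hO h0 hg hg0 hinj
  refine ⟨Λ, ⟨hF ▸ hΛ, fun q hq v hv => ?_⟩, hpΛ, fun q hq => ?_⟩
  · obtain ⟨hqφ, x, hx, hqx, hvx⟩ := hΛq q hq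
    obtain ⟨u, hu⟩ := hvx v hv
    have hqU : q ∈ U := by
      have := (hgU hx).1.2
      rwa [mem_preimage, ← hqx, φ.left_inv hqφ] at this
    refine (hα.ker_eq q hqU v).2 ?_
    rw [← α.inChart_chartDiff hφ hqφ, hu, hqx]
    exact hga x hx u
  · obtain ⟨hqφ, x, hx, hqx, -⟩ := hΛq q hq
    exact (hV q hqφ).2 (hqx ▸ (hgU hx).2)
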